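/- Let $p$ be a prime, let $k$ be a finite field of characteristic $p$, let $W(k)$ be its ring of $p$-typical Witt vectors, and let $n\ge 1$. For a $k$-algebra $R$ let $\sigma$ and $v$ denote the Frobenius and the Verschiebung of Witt vectors, let $W_n(R)$ be the ring of Witt vectors of length $n$, and let $I_{n+1}(R)=\ker(W_{n+1}(R)\to R)=\{v(a)\mid a\in W_n(R)\}$. Let $\underline{W}_n(R)=\bigoplus_{i\in\mathbb{Z}}S_i$ be the $\mathbb{Z}$-graded ring of the truncated Witt frame: $\bigoplus_{i\le 0}S_i=W_n(R)[t]$ is a polynomial ring with $\deg t=-1$, and $S_i=I_{n+1}(R)$ for $i\ge 1$. The product $S_0\times S_i\to S_i$ is the module structure $a\cdot v(b)=v(\sigma(a)b)$ for $i\ge 1$, the product $S_i\times S_j\to S_{i+j}$ is $(v(a),v(b))\mapsto v(ab)$ for $i,j\ge 1$, multiplication by $t$ is the natural map $I_{n+1}(R)\to W_n(R)$ on $S_1$, and it is multiplication by $p$ as a map $S_{i+1}\to S_i$ for $i\ge 1$. This is a graded $W(k)$-algebra via $W(k)\to W_n(R)=S_0$, functorial in $R$, and truncation of Witt vectors gives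 homomorphisms of graded $W(k)$-algebras $\underline{W}_{n+1}(R)\to\underline{W}_n(R)$. Let $X=\operatorname{Spec}A$ be an affine $W(k)$-scheme of finite type with an action of $\mathbb{G}_m$, i.e. with a $\mathbb{Z}$-grading of the $W(k)$-algebra $A$. For a $k$-algebra $R$ let $X_n(R)=X(\underline{W}_n(R))^0$ be the set of homomorphisms of graded $W(k)$-algebras $A\to\underline{W}_n(R)$. Then the functor $X_n$ on $k$-algebras is representable by an affine $k$-scheme of finite type. If $X$ is smooth over $W(k)$ of relative dimension $d$, then $X_n$ is smooth over $k$ of relative dimension $nd$, and the reduction map $X_{n+1}\to X_n$ is surjective and smooth of relative dimension $d$. -/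

import Mathlib

open CategoryTheory AlgebraicGeometry

universe u

/-! ### Frobenius and Verschiebung on truncated Witt vectors of an `𝔽_p`-algebra -/

namespace TruncWitt

variable {p : ℕ} [Fact p.Prime] {n : ℕ} {R : Type*} [CommRing R]

theorem truncate_frobenius_congr (hp : (p : R) = 0) {x y : WittVector p R}
    (h : WittVector.truncate n x = WittVector.truncate n y) :
    WittVector.truncate n (WittVector.frobenius x) =
      WittVector.truncate n (WittVector.frobenius y) := by
  rcases subsingleton_or_nontrivial R with hR | hR
  · exact TruncatedWittVector.ext fun i => Subsingleton.elim _ _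
  · have : CharP R p := (CharP.charP_iff_prime_eq_zero Fact.out).2 hp
    refine TruncatedWittVector.ext fun i => ?_
    have hi := congrArg (TruncatedWittVector.coeff i) h
    rw [WittVector.coeff_truncate, WittVector.coeff_truncate] at hi
    rw [WittVector.coeff_truncate, WittVector.coeff_truncate,
      WittVector.coeff_frobenius_charP, WittVector.coeff_frobenius_charP, hi]

theorem truncate_verschiebung_congr {x y : WittVector p R}
    (h : WittVector.truncate n x = WittVector.truncate n y) :
    WittVector.truncate n (WittVector.verschiebung x) =
      WittVector.truncate n (WittVector.verschiebung y) := by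
  refine TruncatedWittVector.ext fun i => ?_
  obtain ⟨i, hi⟩ := i
  rw [WittVector.coeff_truncate, WittVector.coeff_truncate]
  cases i with
  | zero => simp
  | succ j =>
    have hj := congrArg (TruncatedWittVector.coeff ⟨j, by omega⟩) h
    rw [WittVector.coeff_truncate, WittVector.coeff_truncate] at hj
    simpa using hj

theorem truncate_out (x : TruncatedWittVector p n R) : WittVector.truncate n x.out = x :=
  TruncatedWittVector.truncateFun_out x

/-- The Verschiebung `v : W_n(R) → W_n(R)`, induced by that of `W(R)`. -/
noncomputable def versch : TruncatedWittVector p n R →+ TruncatedWittVector p n R where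
  toFun x := WittVector.truncate n (WittVector.verschiebung x.out)
  map_zero' := by
    rw [truncate_verschiebung_congr (y := 0) (by rw [truncate_out, map_zero]), map_zero, map_zero]
  map_add' x y := by
    rw [← map_add, ← map_add]
    exact truncate_verschiebung_congr (by rw [map_add, truncate_out, truncate_out, truncate_out])

theorem versch_truncate (x : WittVector p R) :
    versch (WittVector.truncate n x) = WittVector.truncate n (WittVector.verschiebung x) :=
  truncate_verschiebung_congr (truncate_out _)

/-- The Frobenius `σ : W_n(R) → W_n(R)`, induced by that of `W(R)`; here `p = 0` in `R`. -/
noncomputable def frob (hp : (p : R) = 0) :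
    TruncatedWittVector p n R →+* TruncatedWittVector p n R where
  toFun x := WittVector.truncate n (WittVector.frobenius x.out)
  map_zero' := by
    rw [truncate_frobenius_congr hp (y := 0) (by rw [truncate_out, map_zero]), map_zero, map_zero]
  map_one' := by
    rw [truncate_frobenius_congr hp (y := 1) (by rw [truncate_out, map_one]), map_one, map_one]
  map_add' x y := by
    rw [← map_add, ← map_add]
    exact truncate_frobenius_congr hp (by rw [map_add, truncate_out, truncate_out, truncate_out])
  map_mul' x y := by
    rw [← map_mul, ← map_mul]
    exact truncate_frobenius_congr hp (by rw [map_mul, truncate_out, truncate_out, truncate_out])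

theorem frob_truncate (hp : (p : R) = 0) (x : WittVector p R) :
    frob hp (WittVector.truncate n x) = WittVector.truncate n (WittVector.frobenius x) :=
  truncate_frobenius_congr hp (truncate_out _)

theorem frob_versch (hp : (p : R) = 0) (x : TruncatedWittVector p n R) :
    frob hp (versch x) = (p : TruncatedWittVector p n R) * x := by
  obtain ⟨x, rfl⟩ := WittVector.truncate_surjective p n R x
  rw [versch_truncate, frob_truncate, WittVector.frobenius_verschiebung, map_mul, map_natCast,
    mul_comm]

theorem versch_frob_mul (hp : (p : R) = 0) (x y : TruncatedWittVector p n R) :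
    versch (frob hp x * y) = x * versch y := by
  obtain ⟨x, rfl⟩ := WittVector.truncate_surjective p n R x
  obtain ⟨y, rfl⟩ := WittVector.truncate_surjective p n R y
  rw [versch_truncate, frob_truncate, ← map_mul, versch_truncate, ← map_mul, mul_comm,
    WittVector.verschiebung_mul_frobenius, mul_comm]

/-- The ring homomorphism `W_n(R) → W_n(R')` induced by a ring homomorphism `R → R'`. -/
noncomputable def map {R' : Type*} [CommRing R'] (f : R →+* R') :
    TruncatedWittVector p n R →+* TruncatedWittVector p n R' :=
  RingHom.liftOfRightInverse (WittVector.truncate n) TruncatedWittVector.out truncate_out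
    ⟨(WittVector.truncate n).comp (WittVector.map f), fun x hx => by
      rw [WittVector.mem_ker_truncate] at hx
      rw [RingHom.mem_ker, RingHom.comp_apply, ← RingHom.mem_ker, WittVector.mem_ker_truncate]
      intro i hi
      rw [WittVector.map_coeff, hx i hi, map_zero]⟩

theorem map_truncate {R' : Type*} [CommRing R'] (f : R →+* R') (x : WittVector p R) :
    map f (WittVector.truncate n x) = WittVector.truncate n (WittVector.map f x) :=
  RingHom.liftOfRightInverse_comp_apply _ _ _ _ x

theorem map_versch {R' : Type*} [CommRing R'] (f : R →+* R') (x : TruncatedWittVector p n R) :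
    map f (versch x) = versch (map f x) := by
  obtain ⟨x, rfl⟩ := WittVector.truncate_surjective p n R x
  rw [versch_truncate, map_truncate, map_truncate, versch_truncate, WittVector.map_verschiebung]

theorem map_frob {R' : Type*} [CommRing R'] (hp : (p : R) = 0) (hp' : (p : R') = 0)
    (f : R →+* R') (x : TruncatedWittVector p n R) :
    map f (frob hp x) = frob hp' (map f x) := by
  obtain ⟨x, rfl⟩ := WittVector.truncate_surjective p n R x
  rw [frob_truncate, map_truncate, map_truncate, frob_truncate]
  rcases subsingleton_or_nontrivial R' with hR | hR
  · exact TruncatedWittVector.ext fun i => Subsingleton.elim _ _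
  · have := f.domain_nontrivial
    have : CharP R p := (CharP.charP_iff_prime_eq_zero Fact.out).2 hp
    have : CharP R' p := (CharP.charP_iff_prime_eq_zero Fact.out).2 hp'
    refine congrArg _ (WittVector.ext fun i => ?_)
    rw [WittVector.map_coeff, WittVector.coeff_frobenius_charP, WittVector.coeff_frobenius_charP,
      WittVector.map_coeff, map_pow]

theorem map_id (x : TruncatedWittVector p n R) : map (RingHom.id R) x = x := by
  obtain ⟨x, rfl⟩ := WittVector.truncate_surjective p n R x
  rw [map_truncate, WittVector.map_id, RingHom.id_apply]

theorem map_map {R' R'' : Type*} [CommRing R'] [CommRing R''] (f : R →+* R') (g : R' →+* R'')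
    (x : TruncatedWittVector p n R) : map g (map f x) = map (g.comp f) x := by
  obtain ⟨x, rfl⟩ := WittVector.truncate_surjective p n R x
  rw [map_truncate, map_truncate, map_truncate]
  congr 1

theorem truncate_versch {m : ℕ} (h : n ≤ m) (x : TruncatedWittVector p m R) :
    TruncatedWittVector.truncate h (versch x) = versch (TruncatedWittVector.truncate h x) := by
  obtain ⟨x, rfl⟩ := WittVector.truncate_surjective p m R x
  rw [versch_truncate, TruncatedWittVector.truncate_wittVector_truncate,
    TruncatedWittVector.truncate_wittVector_truncate, versch_truncate]

theorem truncate_frob {m : ℕ} (h : n ≤ m) (hp : (p : R) = 0) (x : TruncatedWittVector p m R) :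
    TruncatedWittVector.truncate h (frob hp x) = frob hp (TruncatedWittVector.truncate h x) := by
  obtain ⟨x, rfl⟩ := WittVector.truncate_surjective p m R x
  rw [frob_truncate, TruncatedWittVector.truncate_wittVector_truncate,
    TruncatedWittVector.truncate_wittVector_truncate, frob_truncate]

theorem truncate_map {m : ℕ} (h : n ≤ m) {R' : Type*} [CommRing R'] (f : R →+* R')
    (x : TruncatedWittVector p m R) :
    TruncatedWittVector.truncate h (map f x) = map f (TruncatedWittVector.truncate h x) := by
  obtain ⟨x, rfl⟩ := WittVector.truncate_surjective p m R x
  rw [map_truncate, TruncatedWittVector.truncate_wittVector_truncate,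
    TruncatedWittVector.truncate_wittVector_truncate, map_truncate]

end TruncWitt

/-! ### The graded ring of the truncated Witt frame -/

namespace TruncWittFrame

section

variable {p : ℕ} [Fact p.Prime] {n : ℕ} {R : Type*} [CommRing R]

/-- The degree `i` component `τ_i : S_i → S_0 = W_n(R)` of the homomorphism `τ`:
the identity `t^{-i} a ↦ a` for `i ≤ 0`, and `v(a) ↦ p^{i-1} v(a)` for `i ≥ 1`. -/
noncomputable def tau (i : ℤ) : TruncatedWittVector p n R →+ TruncatedWittVector p n R :=
  if i ≤ 0 then AddMonoidHom.id _ else (p ^ (i - 1).toNat) • TruncWitt.versch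

/-- The degree `i` component `σ_i : S_i → S_0 = W_n(R)` of the homomorphism `σ`:
`t^{-i} a ↦ p^{-i} σ(a)` for `i ≤ 0`, and `v(a) ↦ a` for `i ≥ 1`. -/
noncomputable def sigma (hp : (p : R) = 0) (i : ℤ) :
    TruncatedWittVector p n R →+ TruncatedWittVector p n R :=
  if i ≤ 0 then (p ^ (-i).toNat) • (TruncWitt.frob hp).toAddMonoidHom else AddMonoidHom.id _

/-- The product `S_i × S_j → S_{i+j}`. Since `τ` is the identity in degrees `≤ 0` and `σ` is the
identity in degrees `≥ 1`, it is determined by the multiplicativity of `τ` and `σ`. -/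
noncomputable def mul (hp : (p : R) = 0) (i j : ℤ) (a b : TruncatedWittVector p n R) :
    TruncatedWittVector p n R :=
  if i + j ≤ 0 then tau i a * tau j b else sigma hp i a * sigma hp j b

theorem tau_nonpos {i : ℤ} (h : i ≤ 0) (a : TruncatedWittVector p n R) : tau i a = a := by
  simp [tau, h]

theorem tau_pos {i : ℤ} (h : 0 < i) (a : TruncatedWittVector p n R) :
    tau i a = (p : TruncatedWittVector p n R) ^ (i - 1).toNat * TruncWitt.versch a := by
  simp [tau, not_le.2 h, nsmul_eq_mul]

theorem sigma_nonpos (hp : (p : R) = 0) {i : ℤ} (h : i ≤ 0) (a : TruncatedWittVector p n R) :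
    sigma hp i a = (p : TruncatedWittVector p n R) ^ (-i).toNat * TruncWitt.frob hp a := by
  simp [sigma, h, nsmul_eq_mul]

theorem sigma_pos (hp : (p : R) = 0) {i : ℤ} (h : 0 < i) (a : TruncatedWittVector p n R) :
    sigma hp i a = a := by
  simp [sigma, not_le.2 h]

theorem versch_natCast_pow_mul (m : ℕ) (a : TruncatedWittVector p n R) :
    TruncWitt.versch ((p : TruncatedWittVector p n R) ^ m * a) =
      (p : TruncatedWittVector p n R) ^ m * TruncWitt.versch a := by
  have h := map_nsmul (TruncWitt.versch (p := p) (n := n) (R := R)) (p ^ m) a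
  simpa [nsmul_eq_mul] using h

theorem mul_comm' (hp : (p : R) = 0) (i j : ℤ) (a b : TruncatedWittVector p n R) :
    mul hp i j a b = mul hp j i b a := by
  unfold mul
  rw [add_comm j i, mul_comm (tau j b), mul_comm (sigma hp j b)]

theorem mul_add' (hp : (p : R) = 0) (i j : ℤ) (a b c : TruncatedWittVector p n R) :
    mul hp i j a (b + c) = mul hp i j a b + mul hp i j a c := by
  unfold mul
  split_ifs <;> rw [map_add, mul_add]

theorem mul_zero' (hp : (p : R) = 0) (i j : ℤ) (a : TruncatedWittVector p n R) :
    mul hp i j a 0 = 0 := by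
  simp [mul]

theorem tau_mul (hp : (p : R) = 0) (i j : ℤ) (a b : TruncatedWittVector p n R) :
    tau (i + j) (mul hp i j a b) = tau i a * tau j b := by
  rcases le_or_gt (i + j) 0 with h | h
  · rw [tau_nonpos h, mul, if_pos h]
  · wlog hij : i ≤ j generalizing i j a b
    · rw [mul_comm' hp, add_comm i j, mul_comm (tau i a)]
      exact this j i b a (by omega) (by omega)
    rw [tau_pos h, mul, if_neg (not_le.2 h)]
    have hj : 0 < j := by omega
    rw [sigma_pos hp hj, tau_pos hj]
    rcases le_or_gt i 0 with hi | hi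
    · rw [sigma_nonpos hp hi, tau_nonpos hi, mul_assoc, versch_natCast_pow_mul,
        TruncWitt.versch_frob_mul, ← mul_assoc, ← pow_add,
        show (i + j - 1).toNat + (-i).toNat = (j - 1).toNat by omega]
      ring
    · rw [sigma_pos hp hi, tau_pos hi,
        show (i + j - 1).toNat = (i - 1).toNat + (j - 1).toNat + 1 by omega]
      have h2 : TruncWitt.versch a * TruncWitt.versch b =
          (p : TruncatedWittVector p n R) * TruncWitt.versch (a * b) := by
        rw [← TruncWitt.versch_frob_mul hp, TruncWitt.frob_versch, mul_assoc]
        simpa using versch_natCast_pow_mul 1 (a * b)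
      calc _ = (p : TruncatedWittVector p n R) ^ ((i - 1).toNat + (j - 1).toNat) *
            ((p : TruncatedWittVector p n R) * TruncWitt.versch (a * b)) := by ring
        _ = _ := by rw [← h2]; ring

theorem sigma_mul (hp : (p : R) = 0) (i j : ℤ) (a b : TruncatedWittVector p n R) :
    sigma hp (i + j) (mul hp i j a b) = sigma hp i a * sigma hp j b := by
  rcases le_or_gt (i + j) 0 with h | h
  · wlog hij : i ≤ j generalizing i j a b
    · rw [mul_comm' hp, add_comm i j, mul_comm (sigma hp i a)]
      exact this j i b a (by omega) (by omega)
    have hi : i ≤ 0 := by omega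
    rw [sigma_nonpos hp h, mul, if_pos h, tau_nonpos hi, map_mul, sigma_nonpos hp hi]
    rcases le_or_gt j 0 with hj | hj
    · rw [sigma_nonpos hp hj, tau_nonpos hj,
        show (-(i + j)).toNat = (-i).toNat + (-j).toNat by omega]
      ring
    · rw [sigma_pos hp hj, tau_pos hj, map_mul, map_pow, map_natCast, TruncWitt.frob_versch,
        show (-i).toNat = (-(i + j)).toNat + (j - 1).toNat + 1 by omega]
      ring
  · rw [sigma_pos hp h, mul, if_neg (not_le.2 h)]

theorem ext_tau_sigma (hp : (p : R) = 0) (i : ℤ) {a b : TruncatedWittVector p n R}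
    (ht : tau i a = tau i b) (hs : sigma hp i a = sigma hp i b) : a = b := by
  rcases le_or_gt i 0 with h | h
  · rwa [tau_nonpos h, tau_nonpos h] at ht
  · rwa [sigma_pos hp h, sigma_pos hp h] at hs

end

/-- The degree `i` component `S_i` of the truncated Witt frame of the `k`-algebra `R`, where `k`
has characteristic `p`, written in the coordinate `a ∈ W_n(R)`: for `i ≤ 0` the element `a` stands
for `t^{-i} a ∈ S_i = t^{-i} W_n(R)`, and for `i ≥ 1` it stands for the element `v(a)` of
`S_i = I_{n+1}(R)`, where `v : W_n(R) ≃ I_{n+1}(R) = ker (W_{n+1}(R) → R)`. -/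
def Piece (p n : ℕ) (_k R : Type*) (_i : ℤ) : Type _ := TruncatedWittVector p n R

theorem natCast_eq_zero (p : ℕ) (k R : Type*) [Field k] [CharP k p] [CommRing R] [Algebra k R] :
    (p : R) = 0 := by
  rw [← map_natCast (algebraMap k R), CharP.cast_eq_zero, map_zero]

theorem mk_eq_mk {p n : ℕ} {k R : Type*} {i j : ℤ} (h : i = j) {a : Piece p n k R i}
    {b : Piece p n k R j} (hab : (show TruncatedWittVector p n R from a) = b) :
    GradedMonoid.mk i a = GradedMonoid.mk j b := by
  subst h
  exact congrArg _ hab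

section

variable {p : ℕ} [Fact p.Prime] {n : ℕ} {k R : Type*} [Field k] [CharP k p] [CommRing R]
  [Algebra k R]

noncomputable instance (i : ℤ) : AddCommGroup (Piece p n k R i) :=
  inferInstanceAs (AddCommGroup (TruncatedWittVector p n R))

/-- The unit `1 ∈ S_0 = W_n(R)`. -/
noncomputable instance instGOne : GradedMonoid.GOne (Piece p n k R) where
  one := (1 : TruncatedWittVector p n R)

/-- The product of `a ∈ S_i` and `b ∈ S_j` is `mul i j a b`. Explicitly,
it is `ab` if `i, j ≤ 0`, it is `v(a) v(b) := v(ab)` if `i, j ≥ 1`, and for `m ≥ 0`, `j ≥ 1` the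
multiplication by `t^m a` on `S_j` is multiplication by `a` after `t^m`, where `t : S_1 → S_0` is the natural map
`I_{n+1}(R) → W_n(R)` and `t : S_{j+1} → S_j` is multiplication by `p` for `j ≥ 1`. -/
noncomputable instance instGMul : GradedMonoid.GMul (Piece p n k R) where
  mul {i j} a b := mul (natCast_eq_zero p k R) i j a b

/-- The graded ring structure on the family `S_i`. -/
noncomputable instance : DirectSum.GCommRing (Piece p n k R) where
  mul_zero {i j} a := mul_zero' _ i j a
  zero_mul {i j} b := (mul_comm' _ i j 0 b).trans (mul_zero' _ j i b)
  mul_add {i j} a b c := mul_add' _ i j a b c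
  add_mul {i j} a b c := (mul_comm' _ i j _ c).trans ((mul_add' _ j i c a b).trans
    (congrArg₂ _ (mul_comm' _ j i c a) (mul_comm' _ j i c b)))
  one_mul a := by
    refine mk_eq_mk (zero_add _) (ext_tau_sigma (natCast_eq_zero p k R) a.1 ?_ ?_)
    · have h := tau_mul (natCast_eq_zero p k R) 0 a.1 1 a.2
      rwa [tau_nonpos le_rfl, _root_.one_mul, zero_add] at h
    · have h := sigma_mul (natCast_eq_zero p k R) 0 a.1 1 a.2
      rw [sigma_nonpos _ le_rfl, map_one, _root_.mul_one, neg_zero, Int.toNat_zero, pow_zero,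
        _root_.one_mul, zero_add] at h
      exact h
  mul_one a := by
    refine mk_eq_mk (add_zero _) (ext_tau_sigma (natCast_eq_zero p k R) a.1 ?_ ?_)
    · have h := tau_mul (natCast_eq_zero p k R) a.1 0 a.2 1
      rwa [tau_nonpos le_rfl, _root_.mul_one, add_zero] at h
    · have h := sigma_mul (natCast_eq_zero p k R) a.1 0 a.2 1
      rw [sigma_nonpos _ le_rfl, map_one, _root_.mul_one, neg_zero, Int.toNat_zero, pow_zero,
        _root_.mul_one, add_zero] at h
      exact h
  mul_assoc a b c := by
    refine mk_eq_mk (add_assoc _ _ _)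
      (ext_tau_sigma (natCast_eq_zero p k R) (a.1 + b.1 + c.1) ?_ ?_)
    · refine (tau_mul _ (a.1 + b.1) c.1 _ c.2).trans ?_
      rw [add_assoc]
      refine Eq.trans ?_ (tau_mul _ a.1 (b.1 + c.1) a.2 _).symm
      exact (congrArg (· * _) (tau_mul _ a.1 b.1 a.2 b.2)).trans
        ((_root_.mul_assoc _ _ _).trans (congrArg (_ * ·) (tau_mul _ b.1 c.1 b.2 c.2).symm))
    · refine (sigma_mul _ (a.1 + b.1) c.1 _ c.2).trans ?_
      rw [add_assoc]
      refine Eq.trans ?_ (sigma_mul _ a.1 (b.1 + c.1) a.2 _).symm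
      exact (congrArg (· * _) (sigma_mul _ a.1 b.1 a.2 b.2)).trans
        ((_root_.mul_assoc _ _ _).trans (congrArg (_ * ·) (sigma_mul _ b.1 c.1 b.2 c.2).symm))
  mul_comm a b := mk_eq_mk (add_comm _ _) (mul_comm' _ a.1 b.1 a.2 b.2)
  natCast m := (m : TruncatedWittVector p n R)
  natCast_zero := Nat.cast_zero (R := TruncatedWittVector p n R)
  natCast_succ m := Nat.cast_succ (R := TruncatedWittVector p n R) m
  intCast m := (m : TruncatedWittVector p n R)
  intCast_ofNat m := Int.cast_natCast (R := TruncatedWittVector p n R) m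
  intCast_negSucc_ofNat m := Int.cast_negSucc (R := TruncatedWittVector p n R) m

end

end TruncWittFrame

open DirectSum in
/-- The `ℤ`-graded ring `S = ⨁ S_i` of the truncated Witt frame of level `n` of a `k`-algebra
`R`, for a field `k` of characteristic `p`. -/
abbrev TruncWittFrame (p n : ℕ) [Fact p.Prime] (k R : Type*) [Field k] [CharP k p] [CommRing R]
    [Algebra k R] : Type _ :=
  ⨁ i : ℤ, TruncWittFrame.Piece p n k R i

namespace TruncWittFrame

variable {p : ℕ} [Fact p.Prime] {n : ℕ} {k : Type*} [Field k] [CharP k p]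

/-- The inclusion of the homogeneous component `S_i` in `S`. -/
noncomputable def incl (p n : ℕ) [Fact p.Prime] (k R : Type*) [Field k] [CharP k p] [CommRing R]
    [Algebra k R] (i : ℤ) : TruncatedWittVector p n R →+ TruncWittFrame p n k R :=
  DirectSum.of (Piece p n k R) i

theorem incl_mul_incl {R : Type*} [CommRing R] [Algebra k R] (i j : ℤ)
    (a b : TruncatedWittVector p n R) :
    incl p n k R i a * incl p n k R j b =
      incl p n k R (i + j) (mul (natCast_eq_zero p k R) i j a b) :=
  DirectSum.of_mul_of (A := Piece p n k R) a b

/-- The ring homomorphism `W_n(R) = S_0 → S`. -/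
noncomputable def inclZero (p n : ℕ) [Fact p.Prime] (k R : Type*) [Field k] [CharP k p]
    [CommRing R] [Algebra k R] : TruncatedWittVector p n R →+* TruncWittFrame p n k R where
  __ := incl p n k R 0
  map_one' := rfl
  map_mul' a b := by
    refine Eq.trans ?_ (incl_mul_incl (k := k) 0 0 a b).symm
    rw [mul, add_zero, if_pos le_rfl, tau_nonpos le_rfl, tau_nonpos le_rfl]
    rfl

/-- `S` as a `W(k)`-algebra, via `W(k) → W(R) → W_n(R) = S_0`. -/
noncomputable instance {R : Type*} [CommRing R] [Algebra k R] :
    Algebra (WittVector p k) (TruncWittFrame p n k R) :=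
  ((inclZero p n k R).comp
    ((WittVector.truncate n).comp (WittVector.map (algebraMap k R)))).toAlgebra

/-- A ring homomorphism `W_n(R) → W_m(R')` that commutes with `σ` and `v` induces a homomorphism
of graded rings, given by it in all coordinates. -/
noncomputable def mapRingHom {m : ℕ} {R R' : Type*} [CommRing R] [Algebra k R] [CommRing R']
    [Algebra k R'] (f : TruncatedWittVector p n R →+* TruncatedWittVector p m R')
    (hV : ∀ x, f (TruncWitt.versch x) = TruncWitt.versch (f x))
    (hF : ∀ x, f (TruncWitt.frob (natCast_eq_zero p k R) x) =
      TruncWitt.frob (natCast_eq_zero p k R') (f x)) :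
    TruncWittFrame p n k R →+* TruncWittFrame p m k R' :=
  DirectSum.toSemiring (fun i => (incl p m k R' i).comp f.toAddMonoidHom)
    (by
      change inclZero p m k R' (f 1) = 1
      rw [map_one, map_one])
    (by
      intro i j a b
      have ht : ∀ (i : ℤ) (x : TruncatedWittVector p n R), f (tau i x) = tau i (f x) := by
        intro i x
        rcases le_or_gt i 0 with h | h
        · rw [tau_nonpos h, tau_nonpos h]
        · rw [tau_pos h, tau_pos h, map_mul, map_pow, map_natCast, hV]
      have hs : ∀ (i : ℤ) (x : TruncatedWittVector p n R),
          f (sigma (natCast_eq_zero p k R) i x) = sigma (natCast_eq_zero p k R') i (f x) := by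
        intro i x
        rcases le_or_gt i 0 with h | h
        · rw [sigma_nonpos _ h, sigma_nonpos _ h, map_mul, map_pow, map_natCast, hF]
        · rw [sigma_pos _ h, sigma_pos _ h]
      refine Eq.trans ?_ (incl_mul_incl (k := k) i j (f a) (f b)).symm
      change incl p m k R' (i + j) (f (mul _ i j a b)) = _
      refine congrArg _ ?_
      unfold mul
      split_ifs
      · exact (map_mul f _ _).trans (congrArg₂ _ (ht i a) (ht j b))
      · exact (map_mul f _ _).trans (congrArg₂ _ (hs i a) (hs j b)))

theorem mapRingHom_incl {m : ℕ} {R R' : Type*} [CommRing R] [Algebra k R] [CommRing R']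
    [Algebra k R'] (f : TruncatedWittVector p n R →+* TruncatedWittVector p m R')
    (hV : ∀ x, f (TruncWitt.versch x) = TruncWitt.versch (f x))
    (hF : ∀ x, f (TruncWitt.frob (natCast_eq_zero p k R) x) =
      TruncWitt.frob (natCast_eq_zero p k R') (f x)) (i : ℤ) (a : TruncatedWittVector p n R) :
    mapRingHom (k := k) f hV hF (incl p n k R i a) = incl p m k R' i (f a) :=
  DirectSum.toAddMonoid_of (β := Piece p n k R)
    (fun i => (incl p m k R' i).comp f.toAddMonoidHom) i a

/-- The homomorphism of graded `W(k)`-algebras induced by a homomorphism of `k`-algebras. -/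
noncomputable def map {R R' : Type*} [CommRing R] [Algebra k R] [CommRing R'] [Algebra k R']
    (f : R →ₐ[k] R') : TruncWittFrame p n k R →ₐ[WittVector p k] TruncWittFrame p n k R' where
  __ := mapRingHom (TruncWitt.map f.toRingHom) (TruncWitt.map_versch _) (TruncWitt.map_frob _ _ _)
  commutes' x := by
    refine (mapRingHom_incl _ _ _ 0 _).trans (congrArg (incl p n k R' 0) ?_)
    rw [RingHom.comp_apply, TruncWitt.map_truncate, RingHom.comp_apply]
    refine congrArg (WittVector.truncate (p := p) (R := R') n) (WittVector.ext fun i => ?_)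
    simp [WittVector.map_coeff]

theorem map_incl {R R' : Type*} [CommRing R] [Algebra k R] [CommRing R'] [Algebra k R']
    (f : R →ₐ[k] R') (i : ℤ) (a : TruncatedWittVector p n R) :
    map f (incl p n k R i a) = incl p n k R' i (TruncWitt.map f.toRingHom a) :=
  mapRingHom_incl (TruncWitt.map f.toRingHom) (TruncWitt.map_versch _) (TruncWitt.map_frob _ _ _)
    i a

/-- The reduction from level `m` to level `n ≤ m`. -/
noncomputable def reduction {m : ℕ} (h : n ≤ m) (R : Type*) [CommRing R] [Algebra k R] :
    TruncWittFrame p m k R →ₐ[WittVector p k] TruncWittFrame p n k R where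
  __ := mapRingHom (TruncatedWittVector.truncate h) (TruncWitt.truncate_versch h)
    (TruncWitt.truncate_frob h _)
  commutes' x := by
    refine (mapRingHom_incl _ _ _ 0 _).trans (congrArg (incl p n k R 0) ?_)
    rw [RingHom.comp_apply, TruncatedWittVector.truncate_wittVector_truncate]
    rfl

theorem reduction_incl {m : ℕ} (h : n ≤ m) {R : Type*} [CommRing R] [Algebra k R] (i : ℤ)
    (a : TruncatedWittVector p m R) :
    reduction h R (incl p m k R i a) = incl p n k R i (TruncatedWittVector.truncate h a) :=
  mapRingHom_incl (TruncatedWittVector.truncate h) (TruncWitt.truncate_versch h)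
    (TruncWitt.truncate_frob h _) i a

theorem induction_incl {R : Type*} [CommRing R] [Algebra k R]
    {T : Type*} [AddCommMonoid T] {f g : TruncWittFrame p n k R →+ T}
    (h : ∀ i a, f (incl p n k R i a) = g (incl p n k R i a)) : f = g :=
  DirectSum.addHom_ext h

theorem map_id (R : Type*) [CommRing R] [Algebra k R] (x : TruncWittFrame p n k R) :
    map (AlgHom.id k R) x = x := by
  refine DFunLike.congr_fun (f := (map (n := n) (p := p) (AlgHom.id k R)).toRingHom.toAddMonoidHom)
    (g := AddMonoidHom.id _) (induction_incl fun i a => ?_) x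
  exact (map_incl _ i a).trans (congrArg _ (TruncWitt.map_id a))

theorem map_map {R R' R'' : Type*} [CommRing R] [Algebra k R] [CommRing R'] [Algebra k R']
    [CommRing R''] [Algebra k R''] (f : R →ₐ[k] R') (g : R' →ₐ[k] R'')
    (x : TruncWittFrame p n k R) : map g (map f x) = map (g.comp f) x := by
  refine DFunLike.congr_fun
    (f := ((map (n := n) (p := p) g).comp (map f)).toRingHom.toAddMonoidHom)
    (g := (map (n := n) (p := p) (g.comp f)).toRingHom.toAddMonoidHom)
    (induction_incl fun i a => ?_) x
  change map g (map f (incl p n k R i a)) = map (g.comp f) (incl p n k R i a)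
  rw [map_incl, map_incl, map_incl, TruncWitt.map_map]
  rfl

theorem reduction_map {m : ℕ} (h : n ≤ m) {R R' : Type*} [CommRing R] [Algebra k R] [CommRing R']
    [Algebra k R'] (f : R →ₐ[k] R') (x : TruncWittFrame p m k R) :
    reduction h R' (map f x) = map f (reduction h R x) := by
  refine DFunLike.congr_fun
    (f := ((reduction h R').comp (map (n := m) (p := p) f)).toRingHom.toAddMonoidHom)
    (g := ((map (n := n) (p := p) f).comp (reduction h R)).toRingHom.toAddMonoidHom)
    (induction_incl fun i a => ?_) x
  change reduction h R' (map f (incl p m k R i a)) = map f (reduction h R (incl p m k R i a))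
  rw [map_incl, reduction_incl, reduction_incl, map_incl, TruncWitt.truncate_map]

end TruncWittFrame

/-! ### Graded points -/

section GradedPoints

variable (p : ℕ) [Fact p.Prime] {k : Type u} [Field k] [CharP k p] {A : Type u} [CommRing A]
  [Algebra (WittVector p k) A] (𝒜 : ℤ → Submodule (WittVector p k) A)

/-- The set `X(S)^0` of graded points of `X = Spec A`, where the `𝔾_m`-action on `X` is given by the
grading `𝒜` of `A`, in the truncated Witt frame `S` of level `n` of `R`: the homomorphisms of graded
`W(k)`-algebras `A → S`. -/
def GradedPoints (n : ℕ) (R : Type u) [CommRing R] [Algebra k R] : Type u :=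
  {f : A →ₐ[WittVector p k] TruncWittFrame p n k R //
    ∀ i, ∀ a ∈ 𝒜 i, f a ∈ (TruncWittFrame.incl p n k R i).range}

/-- The functor `X_n : R ↦ X(S)^0` on the category of `k`-algebras. -/
noncomputable def gradedPointsFunctor (n : ℕ) : CommAlgCat.{u} k ⥤ Type u where
  obj R := GradedPoints p 𝒜 n R
  map {R R'} g := ↾fun f : GradedPoints p 𝒜 n R =>
    (⟨(TruncWittFrame.map g.hom).comp f.1, fun i a ha => by
      obtain ⟨b, hb⟩ := f.2 i a ha
      exact ⟨_, ((congrArg _ hb.symm).trans (TruncWittFrame.map_incl g.hom i b)).symm⟩⟩ :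
      GradedPoints p 𝒜 n R')
  map_id R := by
    ext f
    exact Subtype.ext (AlgHom.ext fun a => TruncWittFrame.map_id _ _)
  map_comp g g' := by
    ext f
    exact Subtype.ext (AlgHom.ext fun a => (TruncWittFrame.map_map _ _ _).symm)

/-- The reduction map `X_{n+1} → X_n`. -/
noncomputable def gradedPointsReduction (n : ℕ) :
    gradedPointsFunctor p 𝒜 (n + 1) ⟶ gradedPointsFunctor p 𝒜 n where
  app R := ↾fun f : GradedPoints p 𝒜 (n + 1) R =>
    (⟨(TruncWittFrame.reduction n.le_succ R).comp f.1, fun i a ha => by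
      obtain ⟨b, hb⟩ := f.2 i a ha
      exact ⟨_, ((congrArg _ hb.symm).trans
        (TruncWittFrame.reduction_incl n.le_succ i b)).symm⟩⟩ : GradedPoints p 𝒜 n R)
  naturality R R' g := by
    ext f
    exact Subtype.ext (AlgHom.ext fun a => TruncWittFrame.reduction_map _ _ _)

end GradedPoints

section Representing

variable {k : Type u} [CommRing k]

/-- The homomorphism `B → B'` corresponding, by the Yoneda lemma, to a natural transformation
`F' ⟶ F` of functors on `k`-algebras, where `B` represents `F` and `B'` represents `F'`. -/
noncomputable def representingHom {F F' : CommAlgCat.{u} k ⥤ Type u} (α : F' ⟶ F)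
    {B B' : CommAlgCat.{u} k} (h : F.CorepresentableBy B) (h' : F'.CorepresentableBy B') : B ⟶ B' :=
  h.homEquiv.symm (α.app B' (h'.homEquiv (𝟙 B')))

end Representing

/-! ### Square-zero kernels and units for truncated Witt vectors -/

namespace TruncWitt

variable {p : ℕ} [Fact p.Prime] {n : ℕ} {R : Type*} [CommRing R]

/-! Representability is a matter of coordinates. After a choice of finitely many homogeneous
generators of `A`, a graded point over `R` is a tuple of Witt vectors of length `n`, its values at
the generators, subject to the relations of `A`. These relations are polynomial equations in the
Witt coefficients, so `X_n` is closed in an affine space over `k`.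

For smoothness the key fact is that two maps of frames have square-zero kernel: the one induced by
`R → R/I` with `I² = 0`, and the reduction from level `n + 1` to level `n` when `n ≥ 1`
(`ker_map_sq`, `ker_reduction_sq`). Along such a map, an algebra homomorphism `g` lifting a graded
one can be made graded: for `a` of degree `i`, replace `g a` by its component of degree `i`. This
remains multiplicative because the errors multiply to zero (`exists_graded_algHom_of_ker_sq`).
Together with smoothness of `A` it lifts points of `X_n` with values in residue fields to `X_{n+1}`,
which gives surjectivity.

Relative dimensions come from homogeneous étale coordinates. A graded point over `B` induces a
homomorphism `A → B`, the first Witt coefficient in degree zero, which kills all nonzero degrees.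
Near the corresponding primes of `A` there are homogeneous `a_1, …, a_d` whose differentials
generate `Ω` after inverting some `f`, and `f` can be taken of degree zero
(`exists_homogeneous_smul_mem_span`). Hence `Spec A_f → 𝔸^d` is étale, and infinitesimal lifts of a
graded point correspond to lifts of the Witt vectors at the `a_j`, which are unconstrained. The `nd`
Witt coefficients of these values are therefore étale coordinates on `X_n`
(`formallyEtale_wittCoords`). Reduction forgets the last coefficient of each of the `d` Witt
vectors, so it is smooth of relative dimension `d`. -/

theorem coeff_map {R' : Type*} [CommRing R'] (f : R →+* R') (x : TruncatedWittVector p n R)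
    (i : Fin n) : (map f x).coeff i = f (x.coeff i) := by
  obtain ⟨x, rfl⟩ := WittVector.truncate_surjective p n R x
  rw [map_truncate, WittVector.coeff_truncate, WittVector.coeff_truncate, WittVector.map_coeff]

theorem map_surjective {R' : Type*} [CommRing R'] {f : R →+* R'} (hf : Function.Surjective f) :
    Function.Surjective (map (p := p) (n := n) f) := by
  intro y
  choose g hg using hf
  refine ⟨TruncatedWittVector.mk p fun i => g (y.coeff i), TruncatedWittVector.ext fun i => ?_⟩
  rw [coeff_map, TruncatedWittVector.coeff_mk, hg]

/-- The two summands have disjoint supports, so they add coefficientwise. -/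
theorem eq_teichmuller_add_verschiebung (x : WittVector p R) :
    x = WittVector.teichmuller p (x.coeff 0) +
      WittVector.verschiebung (WittVector.mk p fun i => x.coeff (i + 1)) := by
  ext i
  rw [WittVector.coeff_add_of_disjoint]
  · cases i with
    | zero => simp
    | succ i => simp [WittVector.teichmuller_coeff_pos]
  · intro i
    cases i with
    | zero => simp
    | succ i => simp [WittVector.teichmuller_coeff_pos]

/-- In characteristic `p` the Frobenius raises each coefficient to the power `p ≥ 2`. -/
theorem frobenius_eq_zero (hp : (p : R) = 0) {I : Ideal R} (hI : I ^ 2 = ⊥) {x : WittVector p R}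
    (hx : ∀ i, x.coeff i ∈ I) : WittVector.frobenius x = 0 := by
  rcases subsingleton_or_nontrivial R with hR | hR
  · exact WittVector.ext fun i => Subsingleton.elim _ _
  · have : CharP R p := (CharP.charP_iff_prime_eq_zero Fact.out).2 hp
    ext i
    have h2 : x.coeff i ^ 2 = 0 := by
      rw [← Ideal.mem_bot, ← hI]
      exact Ideal.pow_mem_pow (hx i) 2
    rw [WittVector.coeff_frobenius_charP, WittVector.zero_coeff]
    exact pow_eq_zero_of_le (Fact.out : p.Prime).two_le h2

/-- Witt vectors with coefficients in a square-zero ideal of an `𝔽_p`-algebra multiply to zero. -/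
theorem mul_eq_zero_of_coeff_mem (hp : (p : R) = 0) {I : Ideal R} (hI : I ^ 2 = ⊥)
    {x y : WittVector p R} (hx : ∀ i, x.coeff i ∈ I) (hy : ∀ i, y.coeff i ∈ I) : x * y = 0 := by
  -- By the projection formula `a · V b = V(F a · b)`. Splitting each factor into a Teichmüller and
  -- a Verschiebung part, this kills every term except `[x₀][y₀] = [x₀y₀] = 0`.
  have key : ∀ a b : WittVector p R, WittVector.frobenius a = 0 →
      a * WittVector.verschiebung b = 0 := by
    intro a b h
    rw [mul_comm, ← WittVector.verschiebung_mul_frobenius, h, mul_zero, map_zero]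
  have h0 : x.coeff 0 * y.coeff 0 = 0 := by
    rw [← Ideal.mem_bot, ← hI, sq]
    exact Ideal.mul_mem_mul (hx 0) (hy 0)
  have hF : WittVector.frobenius (WittVector.teichmuller p (x.coeff 0)) = 0 :=
    frobenius_eq_zero hp hI fun i => by
      cases i with
      | zero => simpa using hx 0
      | succ i => simp [WittVector.teichmuller_coeff_pos]
  rw [eq_teichmuller_add_verschiebung x, add_mul, mul_comm (WittVector.verschiebung _),
    key y _ (frobenius_eq_zero hp hI hy), add_zero, eq_teichmuller_add_verschiebung y, mul_add,
    key _ _ hF, add_zero, ← map_mul, h0, WittVector.teichmuller_zero]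

theorem ker_map_sq (hp : (p : R) = 0) {R' : Type*} [CommRing R'] {f : R →+* R'}
    (hf : RingHom.ker f ^ 2 = ⊥) : RingHom.ker (map (p := p) (n := n) f) ^ 2 = ⊥ := by
  rw [sq, eq_bot_iff, Ideal.mul_le]
  intro x hx y hy
  have h : ∀ z ∈ RingHom.ker (map (p := p) (n := n) f), ∀ i, z.out.coeff i ∈ RingHom.ker f := by
    intro z hz i
    by_cases hi : i < n
    · have h1 := congrArg (TruncatedWittVector.coeff ⟨i, hi⟩) (RingHom.mem_ker.1 hz)
      rw [coeff_map, TruncatedWittVector.coeff_zero] at h1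
      rwa [RingHom.mem_ker, ← TruncatedWittVector.coeff_out _ ⟨i, hi⟩] at *
    -- `out` pads with zeros beyond index `n`.
    · simp [TruncatedWittVector.out, hi]
  rw [Ideal.mem_bot, ← truncate_out x, ← truncate_out y, ← map_mul,
    mul_eq_zero_of_coeff_mem hp hf (h x hx) (h y hy), map_zero]

theorem truncate_eq_zero_iff_exists_verschiebung (m : ℕ) (x : WittVector p R) :
    WittVector.truncate m x = 0 ↔ ∃ y, x = WittVector.verschiebung^[m] y := by
  rw [← RingHom.mem_ker, WittVector.mem_ker_truncate]
  constructor
  · intro h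
    refine ⟨WittVector.mk p fun i => x.coeff (i + m), WittVector.ext fun i => ?_⟩
    rcases lt_or_ge i m with hi | hi
    · rw [h i hi, WittVector.iterate_verschiebung_coeff_eq_zero _ hi]
    · obtain ⟨j, rfl⟩ := Nat.exists_eq_add_of_le' hi
      rw [WittVector.iterate_verschiebung_coeff, WittVector.coeff_mk]
  · rintro ⟨y, rfl⟩ i hi
    exact WittVector.iterate_verschiebung_coeff_eq_zero _ hi

theorem iterate_verschiebung_mul' (hp : (p : R) = 0) (x y : WittVector p R) (i j : ℕ) :
    ∃ z, WittVector.verschiebung^[i] x * WittVector.verschiebung^[j] y =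
      WittVector.verschiebung^[i + j] z := by
  rcases subsingleton_or_nontrivial R with hR | hR
  · exact ⟨0, WittVector.ext fun i => Subsingleton.elim _ _⟩
  · have : CharP R p := (CharP.charP_iff_prime_eq_zero Fact.out).2 hp
    exact ⟨_, WittVector.iterate_verschiebung_mul x y i j⟩

/-- A product of two elements of `Vⁿ W(R)` lies in `V²ⁿ W(R)`, and `2n ≥ n + 1`. -/
theorem ker_truncate_sq (hp : (p : R) = 0) (hn : 1 ≤ n) :
    RingHom.ker (TruncatedWittVector.truncate (p := p) (R := R) n.le_succ) ^ 2 = ⊥ := by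
  rw [sq, eq_bot_iff, Ideal.mul_le]
  intro x hx y hy
  obtain ⟨x, rfl⟩ := WittVector.truncate_surjective p _ R x
  obtain ⟨y, rfl⟩ := WittVector.truncate_surjective p _ R y
  rw [RingHom.mem_ker, TruncatedWittVector.truncate_wittVector_truncate,
    truncate_eq_zero_iff_exists_verschiebung] at hx hy
  obtain ⟨x, rfl⟩ := hx
  obtain ⟨y, rfl⟩ := hy
  obtain ⟨z, hz⟩ := iterate_verschiebung_mul' hp x y n n
  rw [Ideal.mem_bot, ← map_mul, hz, ← RingHom.mem_ker, WittVector.mem_ker_truncate]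
  intro i hi
  exact WittVector.iterate_verschiebung_coeff_eq_zero _ (by omega)

/-- The projection `W_n(R) → R` to the first coefficient, for `n ≥ 1`. -/
noncomputable def constantCoeff (hn : 1 ≤ n) : TruncatedWittVector p n R →+* R :=
  RingHom.liftOfRightInverse (WittVector.truncate n) TruncatedWittVector.out truncate_out
    ⟨WittVector.constantCoeff, fun x hx => (WittVector.mem_ker_truncate n x).1 hx 0 (by omega)⟩

theorem constantCoeff_truncate (hn : 1 ≤ n) (x : WittVector p R) :
    constantCoeff hn (WittVector.truncate n x) = x.coeff 0 :=
  RingHom.liftOfRightInverse_comp_apply _ _ _ _ x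

theorem constantCoeff_versch (hn : 1 ≤ n) (x : TruncatedWittVector p n R) :
    constantCoeff hn (versch x) = 0 := by
  obtain ⟨x, rfl⟩ := WittVector.truncate_surjective p n R x
  rw [versch_truncate, constantCoeff_truncate, WittVector.verschiebung_coeff_zero]

theorem constantCoeff_map (hn : 1 ≤ n) {R' : Type*} [CommRing R'] (f : R →+* R')
    (x : TruncatedWittVector p n R) : constantCoeff hn (map f x) = f (constantCoeff hn x) := by
  obtain ⟨x, rfl⟩ := WittVector.truncate_surjective p n R x
  rw [map_truncate, constantCoeff_truncate, constantCoeff_truncate, WittVector.map_coeff]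

theorem constantCoeff_truncate' (hn : 1 ≤ n) {m : ℕ} (h : n ≤ m)
    (x : TruncatedWittVector p m R) :
    constantCoeff hn (TruncatedWittVector.truncate h x) = constantCoeff (hn.trans h) x := by
  obtain ⟨x, rfl⟩ := WittVector.truncate_surjective p m R x
  rw [TruncatedWittVector.truncate_wittVector_truncate, constantCoeff_truncate,
    constantCoeff_truncate]

/-- Such an element lifts to some `V y`, and the power `m + 1` of `V y` lies in the image of
`V^(m+1)`. -/
theorem isNilpotent_of_constantCoeff_eq_zero (hp : (p : R) = 0) (hn : 1 ≤ n)
    {x : TruncatedWittVector p n R} (hx : constantCoeff hn x = 0) : IsNilpotent x := by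
  obtain ⟨x, rfl⟩ := WittVector.truncate_surjective p n R x
  rw [constantCoeff_truncate] at hx
  have h1 : ∃ y, x = WittVector.verschiebung^[1] y := by
    rw [← truncate_eq_zero_iff_exists_verschiebung, ← RingHom.mem_ker,
      WittVector.mem_ker_truncate]
    intro i hi
    obtain rfl : i = 0 := by omega
    exact hx
  obtain ⟨y, rfl⟩ := h1
  have h2 : ∀ m, ∃ z, (WittVector.verschiebung^[1] y) ^ (m + 1) =
      WittVector.verschiebung^[m + 1] z := by
    intro m
    induction m with
    | zero => exact ⟨y, by rw [zero_add, pow_one]⟩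
    | succ m ih =>
      obtain ⟨z, hz⟩ := ih
      rw [pow_succ, hz]
      exact iterate_verschiebung_mul' hp z y (m + 1) 1
  obtain ⟨z, hz⟩ := h2 n
  refine ⟨n + 1, ?_⟩
  rw [← map_pow, hz, ← RingHom.mem_ker, WittVector.mem_ker_truncate]
  intro i hi
  exact WittVector.iterate_verschiebung_coeff_eq_zero _ (by omega)

theorem constantCoeff_surjective (hn : 1 ≤ n) :
    Function.Surjective (constantCoeff (p := p) (R := R) hn) := fun r =>
  ⟨WittVector.truncate n (WittVector.teichmuller p r), by
    rw [constantCoeff_truncate, WittVector.teichmuller_coeff_zero]⟩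

/-- Units lift along the surjection `W_n(R) → R`, whose kernel consists of nilpotents. -/
theorem isUnit_of_isUnit_constantCoeff (hp : (p : R) = 0) (hn : 1 ≤ n)
    {x : TruncatedWittVector p n R} (hx : IsUnit (constantCoeff hn x)) : IsUnit x := by
  obtain ⟨r, hr⟩ := hx.exists_right_inv
  obtain ⟨y, rfl⟩ := constantCoeff_surjective (p := p) hn r
  rw [← map_mul] at hr
  have h := isNilpotent_of_constantCoeff_eq_zero hp hn (x := x * y - 1)
    (by rw [map_sub, hr, map_one, sub_self])
  have h2 := h.isUnit_add_one
  rw [sub_add_cancel] at h2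
  exact isUnit_of_mul_isUnit_left h2

end TruncWitt

/-! ### Homogeneous components, grading and constant term of the truncated Witt frame -/

namespace TruncWittFrame

variable {p : ℕ} [Fact p.Prime] {n : ℕ} {k : Type*} [Field k] [CharP k p]

/-- The coordinate in `W_n(R)` of the component of degree `i`. -/
noncomputable def coord (p n : ℕ) [Fact p.Prime] (k R : Type*) [Field k] [CharP k p] [CommRing R]
    [Algebra k R] (i : ℤ) : TruncWittFrame p n k R →+ TruncatedWittVector p n R :=
  DFinsupp.evalAddMonoidHom (β := Piece p n k R) i

section

variable {R : Type*} [CommRing R] [Algebra k R]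

theorem ext_coord {x y : TruncWittFrame p n k R} (h : ∀ i, coord p n k R i x = coord p n k R i y) :
    x = y :=
  DFinsupp.ext h

@[simp]
theorem coord_incl_self (i : ℤ) (a : TruncatedWittVector p n R) :
    coord p n k R i (incl p n k R i a) = a :=
  DirectSum.of_eq_same (β := Piece p n k R) i a

theorem coord_incl_of_ne {i j : ℤ} (h : i ≠ j) (a : TruncatedWittVector p n R) :
    coord p n k R j (incl p n k R i a) = 0 :=
  DirectSum.of_eq_of_ne (β := Piece p n k R) i j a h.symm

theorem incl_injective (i : ℤ) : Function.Injective (incl p n k R i) :=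
  Function.LeftInverse.injective (coord_incl_self (k := k) i)

theorem incl_coord_of_mem {i : ℤ} {x : TruncWittFrame p n k R}
    (hx : x ∈ (incl p n k R i).range) : incl p n k R i (coord p n k R i x) = x := by
  obtain ⟨a, rfl⟩ := hx
  rw [coord_incl_self]

theorem incl_smul (c : WittVector p k) (i : ℤ) (a : TruncatedWittVector p n R) :
    ∃ b, c • incl p n k R i a = incl p n k R i b := by
  refine ⟨mul (natCast_eq_zero p k R) 0 i
    (WittVector.truncate n (WittVector.map (algebraMap k R) c)) a, ?_⟩
  rw [Algebra.smul_def]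
  refine (incl_mul_incl (k := k) 0 i _ a).trans ?_
  rw [zero_add]
  rfl

variable (p n k R) in
/-- The submodule `S_i` of `S`. -/
noncomputable def grading (i : ℤ) : Submodule (WittVector p k) (TruncWittFrame p n k R) where
  __ := (incl p n k R i).range
  smul_mem' := by
    rintro c _ ⟨a, rfl⟩
    obtain ⟨b, hb⟩ := incl_smul c i a
    exact ⟨b, hb.symm⟩

theorem incl_mem_grading (i : ℤ) (a : TruncatedWittVector p n R) :
    incl p n k R i a ∈ grading p n k R i :=
  ⟨a, rfl⟩

variable (p n k R) in
/-- The inclusion of `S_i`, with values in `grading p n k R i`. -/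
noncomputable def inclGrading (i : ℤ) : TruncatedWittVector p n R →+ grading p n k R i :=
  (incl p n k R i).codRestrict (grading p n k R i) (incl_mem_grading i)

open DirectSum in
/-- The decomposition of `S` into homogeneous components. -/
noncomputable def decomposeHom : TruncWittFrame p n k R →+ ⨁ i, grading p n k R i :=
  DirectSum.toAddMonoid (β := Piece p n k R) fun i =>
    (DirectSum.of (fun i => grading p n k R i) i).comp (inclGrading p n k R i)

theorem decomposeHom_incl (i : ℤ) (a : TruncatedWittVector p n R) :
    decomposeHom (incl p n k R i a) =
      DirectSum.of (fun i => grading p n k R i) i (inclGrading p n k R i a) :=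
  DirectSum.toAddMonoid_of (β := Piece p n k R) _ i a

/-- The internal form of the grading, to which the lifting results for graded algebras apply. -/
noncomputable instance : GradedAlgebra (grading p n k R) where
  one_mem := ⟨1, (inclZero p n k R).map_one⟩
  mul_mem := by
    rintro i j _ _ ⟨a, rfl⟩ ⟨b, rfl⟩
    exact ⟨_, (incl_mul_incl i j a b).symm⟩
  __ := DirectSum.Decomposition.ofAddHom (grading p n k R) decomposeHom
    (by
      refine induction_incl fun i a => ?_
      rw [AddMonoidHom.comp_apply, decomposeHom_incl, DirectSum.coeAddMonoidHom_of]
      rfl)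
    (by
      refine DirectSum.addHom_ext fun i a => ?_
      obtain ⟨_, a, rfl⟩ := a
      rw [AddMonoidHom.comp_apply, DirectSum.coeAddMonoidHom_of]
      exact decomposeHom_incl i a)

theorem coe_decompose (i : ℤ) (x : TruncWittFrame p n k R) :
    (DirectSum.decompose (grading p n k R) x i : TruncWittFrame p n k R) =
      incl p n k R i (coord p n k R i x) := by
  refine DFunLike.congr_fun (f := (GradedRing.proj (grading p n k R) i))
    (g := (incl p n k R i).comp (coord p n k R i)) (induction_incl fun j a => ?_) x
  rw [GradedRing.proj_apply, AddMonoidHom.comp_apply]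
  by_cases h : j = i
  · subst h
    rw [coord_incl_self, DirectSum.decompose_of_mem_same (grading p n k R) (incl_mem_grading j a)]
  · rw [coord_incl_of_ne h, map_zero,
      DirectSum.decompose_of_mem_ne (grading p n k R) (incl_mem_grading j a) h]

end

/-! ### Maps of frames and their square-zero kernels. -/

section mapRingHom

variable {m : ℕ} {R R' : Type*} [CommRing R] [Algebra k R] [CommRing R'] [Algebra k R']
  {f : TruncatedWittVector p n R →+* TruncatedWittVector p m R'}
  (hV : ∀ x, f (TruncWitt.versch x) = TruncWitt.versch (f x))
  (hF : ∀ x, f (TruncWitt.frob (natCast_eq_zero p k R) x) =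
    TruncWitt.frob (natCast_eq_zero p k R') (f x))

theorem coord_mapRingHom (i : ℤ) (x : TruncWittFrame p n k R) :
    coord p m k R' i (mapRingHom f hV hF x) = f (coord p n k R i x) := by
  refine DFunLike.congr_fun
    (f := (coord p m k R' i).comp (mapRingHom (k := k) f hV hF).toAddMonoidHom)
    (g := f.toAddMonoidHom.comp (coord p n k R i)) (induction_incl fun j a => ?_) x
  change coord p m k R' i (mapRingHom f hV hF (incl p n k R j a)) =
    f (coord p n k R i (incl p n k R j a))
  rw [mapRingHom_incl]
  by_cases h : j = i
  · subst h
    rw [coord_incl_self, coord_incl_self]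
  · rw [coord_incl_of_ne h, coord_incl_of_ne h, map_zero]

theorem mapRingHom_surjective (hf : Function.Surjective f) :
    Function.Surjective (mapRingHom (k := k) f hV hF) := by
  intro y
  have : y ∈ (mapRingHom (k := k) f hV hF).range := by
    induction y using DirectSum.induction_on with
    | zero => exact zero_mem _
    | of i y =>
      obtain ⟨x, rfl⟩ := hf y
      exact ⟨_, mapRingHom_incl f hV hF i x⟩
    | add x y hx hy => exact add_mem hx hy
  exact this

include hV hF in
-- A product in the frame is a product in `W_n(R)` of two values of `tau` or two values of `sigma`,
-- and both preserve the kernel of `f` because `f` commutes with `v` and `σ`.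
theorem mul_eq_zero_of_mem_ker (hf : RingHom.ker f ^ 2 = ⊥) (i j : ℤ)
    {a b : TruncatedWittVector p n R} (ha : f a = 0) (hb : f b = 0) :
    mul (natCast_eq_zero p k R) i j a b = 0 := by
  have ht : ∀ (i : ℤ) (x : TruncatedWittVector p n R), f x = 0 → f (tau i x) = 0 := by
    intro i x hx
    rcases le_or_gt i 0 with h | h
    · rwa [tau_nonpos h]
    · rw [tau_pos h, map_mul, hV, hx, map_zero, mul_zero]
  have hs : ∀ (i : ℤ) (x : TruncatedWittVector p n R), f x = 0 →
      f (sigma (natCast_eq_zero p k R) i x) = 0 := by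
    intro i x hx
    rcases le_or_gt i 0 with h | h
    · rw [sigma_nonpos _ h, map_mul, hF, hx, map_zero, mul_zero]
    · rwa [sigma_pos _ h]
  have h2 : ∀ x y, f x = 0 → f y = 0 → x * y = 0 := by
    intro x y hx hy
    rw [← Ideal.mem_bot, ← hf, sq]
    exact Ideal.mul_mem_mul hx hy
  unfold mul
  split_ifs
  · exact h2 _ _ (ht i a ha) (ht j b hb)
  · exact h2 _ _ (hs i a ha) (hs j b hb)

theorem sum_incl_coord (x : TruncWittFrame p n k R) :
    ∃ s : Finset ℤ, x = ∑ i ∈ s, incl p n k R i (coord p n k R i x) := by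
  classical
  refine ⟨DFinsupp.support (DirectSum.decompose (grading p n k R) x), ?_⟩
  conv_lhs => rw [← DirectSum.sum_support_decompose (grading p n k R) x]
  exact Finset.sum_congr rfl fun i _ => coe_decompose i x

theorem ker_mapRingHom_sq (hf : RingHom.ker f ^ 2 = ⊥) :
    RingHom.ker (mapRingHom (k := k) f hV hF) ^ 2 = ⊥ := by
  rw [sq, eq_bot_iff, Ideal.mul_le]
  intro x hx y hy
  have h : ∀ x ∈ RingHom.ker (mapRingHom (k := k) f hV hF), ∀ i, f (coord p n k R i x) = 0 := by
    intro x hx i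
    rw [← coord_mapRingHom (k := k) hV hF, RingHom.mem_ker.1 hx, map_zero]
  obtain ⟨s, hs⟩ := sum_incl_coord x
  obtain ⟨t, ht⟩ := sum_incl_coord y
  rw [Ideal.mem_bot, hs, ht, Finset.sum_mul_sum]
  refine Finset.sum_eq_zero fun i _ => Finset.sum_eq_zero fun j _ => ?_
  rw [incl_mul_incl, mul_eq_zero_of_mem_ker (k := k) hV hF hf i j (h x hx i) (h y hy j), map_zero]

end mapRingHom

section

variable {R R' : Type*} [CommRing R] [Algebra k R] [CommRing R'] [Algebra k R']

theorem coord_map (f : R →ₐ[k] R') (i : ℤ) (x : TruncWittFrame p n k R) :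
    coord p n k R' i (map f x) = TruncWitt.map f.toRingHom (coord p n k R i x) :=
  coord_mapRingHom (TruncWitt.map_versch _) (TruncWitt.map_frob _ _ _) i x

theorem map_surjective {f : R →ₐ[k] R'} (hf : Function.Surjective f) :
    Function.Surjective (map (p := p) (n := n) f) :=
  mapRingHom_surjective (TruncWitt.map_versch _) (TruncWitt.map_frob _ _ _)
    (TruncWitt.map_surjective hf)

theorem ker_map_sq {f : R →ₐ[k] R'} (hf : RingHom.ker f ^ 2 = ⊥) :
    RingHom.ker (map (p := p) (n := n) f) ^ 2 = ⊥ :=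
  ker_mapRingHom_sq (TruncWitt.map_versch _) (TruncWitt.map_frob _ _ _)
    (TruncWitt.ker_map_sq (natCast_eq_zero p k R) hf)

theorem reduction_surjective (R : Type*) [CommRing R] [Algebra k R] :
    Function.Surjective (reduction (p := p) (k := k) n.le_succ R) :=
  mapRingHom_surjective (TruncWitt.truncate_versch _) (TruncWitt.truncate_frob _ _)
    (TruncatedWittVector.truncate_surjective _)

theorem ker_reduction_sq (hn : 1 ≤ n) (R : Type*) [CommRing R] [Algebra k R] :
    RingHom.ker (reduction (p := p) (k := k) n.le_succ R) ^ 2 = ⊥ :=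
  ker_mapRingHom_sq (TruncWitt.truncate_versch _) (TruncWitt.truncate_frob _ _)
    (TruncWitt.ker_truncate_sq (natCast_eq_zero p k R) hn)

theorem map_mem_grading (f : R →ₐ[k] R') {i : ℤ} {x : TruncWittFrame p n k R}
    (hx : x ∈ grading p n k R i) : map f x ∈ grading p n k R' i := by
  obtain ⟨a, rfl⟩ := hx
  exact ⟨_, (map_incl f i a).symm⟩

theorem reduction_mem_grading {i : ℤ} {x : TruncWittFrame p (n + 1) k R}
    (hx : x ∈ grading p (n + 1) k R i) : reduction n.le_succ R x ∈ grading p n k R i := by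
  obtain ⟨a, rfl⟩ := hx
  exact ⟨_, (reduction_incl n.le_succ i a).symm⟩

/-! ### The constant term homomorphism from the frame to `R`. -/

variable (p R) in
/-- The component of degree `i` of `constantTerm`. -/
noncomputable def constantTermPiece (hn : 1 ≤ n) (i : ℤ) : TruncatedWittVector p n R →+ R :=
  if i = 0 then (TruncWitt.constantCoeff hn).toAddMonoidHom else 0

theorem constantTermPiece_zero (hn : 1 ≤ n) {i : ℤ} (hi : i = 0) (a : TruncatedWittVector p n R) :
    constantTermPiece p R hn i a = TruncWitt.constantCoeff hn a := by
  rw [constantTermPiece, if_pos hi]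
  rfl

theorem constantTermPiece_of_ne (hn : 1 ≤ n) {i : ℤ} (hi : i ≠ 0)
    (a : TruncatedWittVector p n R) : constantTermPiece p R hn i a = 0 := by
  rw [constantTermPiece, if_neg hi, AddMonoidHom.zero_apply]

/-- Projection to degree zero is not multiplicative, since opposite degrees also multiply into
degree zero. In that case the factor of positive degree contributes a multiple of a Verschiebung,
whose first coefficient vanishes. -/
theorem constantTermPiece_mul (hp : (p : R) = 0) (hn : 1 ≤ n) (i j : ℤ)
    (a b : TruncatedWittVector p n R) :
    constantTermPiece p R hn (i + j) (mul hp i j a b) =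
      constantTermPiece p R hn i a * constantTermPiece p R hn j b := by
  have ht : ∀ (i : ℤ) (x : TruncatedWittVector p n R), 0 < i →
      TruncWitt.constantCoeff hn (tau i x) = 0 := by
    intro i x hi
    rw [tau_pos hi, map_mul, TruncWitt.constantCoeff_versch, mul_zero]
  by_cases hij : i + j = 0
  · rw [constantTermPiece_zero hn hij, mul, if_pos hij.le, map_mul]
    rcases lt_trichotomy i 0 with hi | hi | hi
    · rw [ht j b (by omega), mul_zero, constantTermPiece_of_ne hn hi.ne, zero_mul]
    · rw [tau_nonpos (by omega), tau_nonpos (by omega), constantTermPiece_zero hn hi,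
        constantTermPiece_zero hn (by omega)]
    · rw [ht i a hi, zero_mul, constantTermPiece_of_ne hn hi.ne', zero_mul]
  · rw [constantTermPiece_of_ne hn hij]
    rcases ne_or_eq i 0 with hi | hi
    · rw [constantTermPiece_of_ne hn hi, zero_mul]
    · rw [constantTermPiece_of_ne hn (show j ≠ 0 by omega), mul_zero]

variable (p k R) in
/-- The ring homomorphism `S → W_n(R) → R` given by the first Witt coefficient of the component of
degree zero. -/
noncomputable def constantTerm (hn : 1 ≤ n) : TruncWittFrame p n k R →+* R :=
  DirectSum.toSemiring (A := Piece p n k R) (constantTermPiece p R hn)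
    ((constantTermPiece_zero hn rfl _).trans (map_one _))
    (fun {i j} a b => constantTermPiece_mul (natCast_eq_zero p k R) hn i j a b)

theorem constantTerm_incl (hn : 1 ≤ n) (i : ℤ) (a : TruncatedWittVector p n R) :
    constantTerm p k R hn (incl p n k R i a) = constantTermPiece p R hn i a :=
  DirectSum.toAddMonoid_of (β := Piece p n k R) (constantTermPiece p R hn) i a

theorem constantTerm_incl_zero (hn : 1 ≤ n) (a : TruncatedWittVector p n R) :
    constantTerm p k R hn (incl p n k R 0 a) = TruncWitt.constantCoeff hn a :=
  (constantTerm_incl hn 0 a).trans (constantTermPiece_zero hn rfl a)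

theorem constantTerm_incl_of_ne (hn : 1 ≤ n) {i : ℤ} (hi : i ≠ 0) (a : TruncatedWittVector p n R) :
    constantTerm p k R hn (incl p n k R i a) = 0 :=
  (constantTerm_incl hn i a).trans (constantTermPiece_of_ne hn hi a)

theorem constantTerm_map (hn : 1 ≤ n) (f : R →ₐ[k] R') (x : TruncWittFrame p n k R) :
    constantTerm p k R' hn (map f x) = f (constantTerm p k R hn x) := by
  refine DFunLike.congr_fun
    (f := ((constantTerm p k R' hn).comp (map f).toRingHom).toAddMonoidHom)
    (g := (f.toRingHom.comp (constantTerm p k R hn)).toAddMonoidHom)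
    (induction_incl fun i a => ?_) x
  change constantTerm p k R' hn (map f (incl p n k R i a)) =
    f (constantTerm p k R hn (incl p n k R i a))
  rw [map_incl]
  by_cases hi : i = 0
  · subst hi
    rw [constantTerm_incl_zero, constantTerm_incl_zero, TruncWitt.constantCoeff_map]
    rfl
  · rw [constantTerm_incl_of_ne hn hi, constantTerm_incl_of_ne hn hi, map_zero]

theorem constantTerm_reduction (hn : 1 ≤ n) (x : TruncWittFrame p (n + 1) k R) :
    constantTerm p k R hn (reduction n.le_succ R x) =
      constantTerm p k R (hn.trans n.le_succ) x := by
  refine DFunLike.congr_fun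
    (f := ((constantTerm p k R hn).comp (reduction n.le_succ R).toRingHom).toAddMonoidHom)
    (g := (constantTerm p k R (hn.trans n.le_succ)).toAddMonoidHom)
    (induction_incl fun i a => ?_) x
  change constantTerm p k R hn (reduction n.le_succ R (incl p (n + 1) k R i a)) =
    constantTerm p k R _ (incl p (n + 1) k R i a)
  rw [reduction_incl]
  by_cases hi : i = 0
  · subst hi
    rw [constantTerm_incl_zero, constantTerm_incl_zero, TruncWitt.constantCoeff_truncate']
  · rw [constantTerm_incl_of_ne hn hi, constantTerm_incl_of_ne _ hi]

/-- This turns invertibility of a degree zero element of the frame into invertibility of a single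
function on `Spec R`. -/
theorem isUnit_of_isUnit_constantTerm (hn : 1 ≤ n) {x : TruncWittFrame p n k R}
    (hx : x ∈ grading p n k R 0) (h : IsUnit (constantTerm p k R hn x)) : IsUnit x := by
  obtain ⟨a, rfl⟩ := hx
  rw [constantTerm_incl_zero] at h
  exact (TruncWitt.isUnit_of_isUnit_constantCoeff (natCast_eq_zero p k R) hn h).map
    (inclZero p n k R)

end

end TruncWittFrame

/-! ### Graded lifts along square-zero extensions -/

section GradedHom

variable {W A B : Type*} [CommRing W] [CommRing A] [Algebra W A] [Ring B] [Algebra W B]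
  (𝒜 : ℤ → Submodule W A) [GradedAlgebra 𝒜]

/-- The homomorphism of algebras on a graded algebra given by its homogeneous components. -/
noncomputable def GradedAlgebra.liftAlgHom (f : ∀ i, 𝒜 i →ₗ[W] B)
    (hone : f 0 ⟨1, SetLike.GradedOne.one_mem⟩ = 1)
    (hmul : ∀ (i j : ℤ) (a : 𝒜 i) (b : 𝒜 j),
      f (i + j) ⟨a * b, SetLike.GradedMul.mul_mem a.2 b.2⟩ = f i a * f j b) : A →ₐ[W] B :=
  (DirectSum.toAlgebra W (fun i => 𝒜 i) f hone (fun {i j} a b => hmul i j a b)).comp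
    (DirectSum.decomposeAlgEquiv 𝒜).toAlgHom

theorem GradedAlgebra.liftAlgHom_apply {f : ∀ i, 𝒜 i →ₗ[W] B}
    (hone : f 0 ⟨1, SetLike.GradedOne.one_mem⟩ = 1)
    (hmul : ∀ (i j : ℤ) (a : 𝒜 i) (b : 𝒜 j),
      f (i + j) ⟨a * b, SetLike.GradedMul.mul_mem a.2 b.2⟩ = f i a * f j b)
    {i : ℤ} {a : A} (ha : a ∈ 𝒜 i) :
    GradedAlgebra.liftAlgHom 𝒜 f hone hmul a = f i ⟨a, ha⟩ := by
  change DirectSum.toAlgebra W (fun i => 𝒜 i) f hone (fun {i j} a b => hmul i j a b)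
    (DirectSum.decompose 𝒜 a) = _
  rw [DirectSum.decompose_of_mem 𝒜 ha]
  exact DirectSum.toAddMonoid_of (fun i => (f i).toAddMonoidHom) i ⟨a, ha⟩

end GradedHom

section GradedLift

variable {W A S S' : Type*} [CommRing W] [CommRing A] [CommRing S] [CommRing S'] [Algebra W A]
  [Algebra W S] [Algebra W S'] (𝒜 : ℤ → Submodule W A) [GradedAlgebra 𝒜]
  (𝒮 : ℤ → Submodule W S) [GradedAlgebra 𝒮] (𝒮' : ℤ → Submodule W S') [GradedAlgebra 𝒮']

theorem map_coe_decompose_of_forall_mem {π : S →ₐ[W] S'} (hπ : ∀ i, ∀ s ∈ 𝒮 i, π s ∈ 𝒮' i) (s : S)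
    (i : ℤ) : π (DirectSum.decompose 𝒮 s i) = DirectSum.decompose 𝒮' (π s) i := by
  induction s using DirectSum.Decomposition.inductionOn 𝒮 with
  | zero => simp
  | @homogeneous j s =>
    by_cases h : j = i
    · subst h
      rw [DirectSum.decompose_of_mem_same 𝒮 s.2, DirectSum.decompose_of_mem_same 𝒮' (hπ j s s.2)]
    · rw [DirectSum.decompose_of_mem_ne 𝒮 s.2 h, DirectSum.decompose_of_mem_ne 𝒮' (hπ j s s.2) h,
        map_zero]
  | add s t hs ht => simp [DirectSum.decompose_add, hs, ht]

/-- If `g : A → S` is a homomorphism of algebras that is graded modulo a square-zero ideal, then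
taking on homogeneous elements the component of `g` of the same degree is multiplicative. -/
theorem exists_algHom_eq_coe_decompose {J : Ideal S} (hJ : J ^ 2 = ⊥) (g : A →ₐ[W] S)
    (hg : ∀ i, ∀ a ∈ 𝒜 i, g a - DirectSum.decompose 𝒮 (g a) i ∈ J) :
    ∃ g' : A →ₐ[W] S, ∀ i, ∀ a ∈ 𝒜 i, g' a = DirectSum.decompose 𝒮 (g a) i := by
  let f : ∀ i, 𝒜 i →ₗ[W] S := fun i =>
    (GradedAlgebra.proj 𝒮 i) ∘ₗ g.toLinearMap ∘ₗ (𝒜 i).subtype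
  have hf : ∀ i (a : 𝒜 i), f i a = DirectSum.decompose 𝒮 (g a) i := fun i a => rfl
  have hone : f 0 ⟨1, SetLike.GradedOne.one_mem⟩ = 1 := by
    rw [hf]
    change ((DirectSum.decompose 𝒮 (g (1 : A)) 0 : 𝒮 0) : S) = 1
    rw [map_one, DirectSum.decompose_of_mem_same 𝒮 SetLike.GradedOne.one_mem]
  have hmul : ∀ (i j : ℤ) (a : 𝒜 i) (b : 𝒜 j),
      f (i + j) ⟨a * b, SetLike.GradedMul.mul_mem a.2 b.2⟩ = f i a * f j b := by
    intro i j a b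
    rw [hf, hf, hf]
    change ((DirectSum.decompose 𝒮 (g ((a : A) * b)) (i + j) : 𝒮 (i + j)) : S) = _
    set α := DirectSum.decompose 𝒮 (g a) i with hα
    set β := DirectSum.decompose 𝒮 (g b) j with hβ
    have h1 : (g a - α) * (g b - β) = 0 := by
      rw [← Ideal.mem_bot, ← hJ, sq]
      exact Ideal.mul_mem_mul (hg i a a.2) (hg j b b.2)
    -- This is `h1` expanded. In degree `i + j` each of the three products on the right contributes
    -- `αβ`, with signs `+`, `+`, `-`.
    have h2 : g (a * b) = α * g b + g a * β - (α : S) * β := by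
      rw [map_mul]
      linear_combination h1
    rw [h2, DirectSum.decompose_sub, DirectSum.decompose_add, DirectSum.sub_apply,
      DirectSum.add_apply, AddSubgroupClass.coe_sub, Submodule.coe_add,
      DirectSum.coe_decompose_mul_add_of_left_mem 𝒮 α.2,
      DirectSum.coe_decompose_mul_add_of_right_mem 𝒮 β.2,
      DirectSum.decompose_of_mem_same 𝒮 (SetLike.GradedMul.mul_mem α.2 β.2), ← hα, ← hβ]
    ring
  exact ⟨GradedAlgebra.liftAlgHom 𝒜 f hone hmul, fun i a ha =>
    GradedAlgebra.liftAlgHom_apply 𝒜 hone hmul ha⟩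

/-- Since `π ∘ g` is already graded, `g a` differs from its component of the expected degree by an
element of `ker π`. Hence a lift provided by ordinary smoothness can be replaced by a graded one
with the same reduction. -/
theorem exists_graded_algHom_of_ker_sq {π : S →ₐ[W] S'} (hπ : ∀ i, ∀ s ∈ 𝒮 i, π s ∈ 𝒮' i)
    (hker : RingHom.ker π ^ 2 = ⊥) (g : A →ₐ[W] S) (hg : ∀ i, ∀ a ∈ 𝒜 i, π (g a) ∈ 𝒮' i) :
    ∃ g' : A →ₐ[W] S, (∀ i, ∀ a ∈ 𝒜 i, g' a = DirectSum.decompose 𝒮 (g a) i) ∧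
      π.comp g' = π.comp g := by
  obtain ⟨g', hg'⟩ := exists_algHom_eq_coe_decompose 𝒜 𝒮 hker g fun i a ha => by
    rw [RingHom.mem_ker, map_sub, map_coe_decompose_of_forall_mem 𝒮 𝒮' hπ,
      DirectSum.decompose_of_mem_same 𝒮' (hg i a ha), sub_self]
  refine ⟨g', hg', AlgHom.ext fun a => ?_⟩
  induction a using DirectSum.Decomposition.inductionOn 𝒜 with
  | zero => simp
  | @homogeneous i a =>
    rw [AlgHom.comp_apply, AlgHom.comp_apply, hg' i a a.2,
      map_coe_decompose_of_forall_mem 𝒮 𝒮' hπ, DirectSum.decompose_of_mem_same 𝒮' (hg i a a.2)]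
  | add a b ha hb => rw [map_add, map_add, ha, hb]

end GradedLift

/-! ### Degree zero components of annihilators of differentials -/

section GradedDifferentials

variable {W A : Type*} [CommRing W] [CommRing A] [Algebra W A] (𝒜 : ℤ → Submodule W A)

/-- The module `∏_{m ∈ ℤ} M` over a graded ring `A`, on which `a ∈ A_i` acts by multiplication with
`a` and a shift by `i`. -/
def ShiftModule (_𝒜 : ℤ → Submodule W A) (M : Type*) : Type _ := ℤ → M

namespace ShiftModule

variable (M : Type*) [AddCommGroup M]

instance : AddCommGroup (ShiftModule 𝒜 M) := inferInstanceAs (AddCommGroup (ℤ → M))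

variable {𝒜 M} in
theorem add_apply (c c' : ShiftModule 𝒜 M) (m : ℤ) : (c + c') m = c m + c' m :=
  rfl

variable [GradedAlgebra 𝒜] [Module W M] [Module A M] [IsScalarTower W A M]

instance : Module W (ShiftModule 𝒜 M) := inferInstanceAs (Module W (ℤ → M))

/-- The action of a homogeneous element on the shift module. -/
def shift (i : ℤ) : 𝒜 i →ₗ[W] Module.End W (ShiftModule 𝒜 M) where
  toFun a :=
    { toFun := fun c m => (a : A) • c (m - i)
      map_add' := fun c c' => funext fun m => smul_add (a : A) (c (m - i)) (c' (m - i))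
      map_smul' := fun w c => funext fun m => smul_algebra_smul_comm w (a : A) (c (m - i)) }
  map_add' a b := LinearMap.ext fun c => funext fun m => add_smul (a : A) (b : A) (c (m - i))
  map_smul' w a := LinearMap.ext fun c => funext fun m => smul_assoc w (a : A) (c (m - i))

/-- The action of a graded ring on the shift module. -/
noncomputable def action : A →ₐ[W] Module.End W (ShiftModule 𝒜 M) :=
  GradedAlgebra.liftAlgHom 𝒜 (shift 𝒜 M)
    (LinearMap.ext fun c => funext fun m => by
      change (1 : A) • c (m - 0) = c m
      rw [one_smul, sub_zero])
    (fun i j a b => LinearMap.ext fun c => funext fun m => by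
      change ((a : A) * b) • c (m - (i + j)) = (a : A) • (b : A) • c (m - i - j)
      rw [mul_smul, sub_sub])

noncomputable instance : Module A (ShiftModule 𝒜 M) :=
  Module.compHom (ShiftModule 𝒜 M) (action 𝒜 M).toRingHom

instance : IsScalarTower W A (ShiftModule 𝒜 M) :=
  ⟨fun w a c => by
    change action 𝒜 M (w • a) c = w • action 𝒜 M a c
    rw [map_smul, LinearMap.smul_apply]⟩

variable {𝒜 M}

theorem smul_apply {i : ℤ} {a : A} (ha : a ∈ 𝒜 i) (c : ShiftModule 𝒜 M) (m : ℤ) :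
    (a • c) m = a • c (m - i) := by
  have h : action 𝒜 M a = shift 𝒜 M i ⟨a, ha⟩ := GradedAlgebra.liftAlgHom_apply 𝒜 _ _ ha
  change action 𝒜 M a c m = _
  rw [h]
  rfl

variable (𝒜) in
/-- The derivation with values in the shift module given by a derivation on all homogeneous
components. -/
noncomputable def derivation (δ : Derivation W A M) : Derivation W A (ShiftModule 𝒜 M) :=
  Derivation.mk' (M := ShiftModule 𝒜 M)
    { toFun := fun y m => δ (DirectSum.decompose 𝒜 y m)
      map_add' := fun x y => funext fun m => by
        rw [DirectSum.decompose_add, DirectSum.add_apply, Submodule.coe_add, map_add]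
        rfl
      map_smul' := fun w y => funext fun m => by
        rw [DirectSum.decompose_smul, DirectSum.smul_apply, Submodule.coe_smul, Derivation.map_smul]
        rfl }
    (by
      intro x y
      induction x using DirectSum.Decomposition.inductionOn 𝒜 with
      | zero => simp
      | add x x' hx hx' => rw [add_mul, map_add, map_add, hx, hx', add_smul, smul_add]; abel
      | @homogeneous i x =>
      induction y using DirectSum.Decomposition.inductionOn 𝒜 with
      | zero => simp
      | add y y' hy hy' => rw [mul_add, map_add, map_add, hy, hy', add_smul, smul_add]; abel
      | @homogeneous j y =>
      funext m
      rw [add_apply, smul_apply x.2, smul_apply y.2]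
      change δ (DirectSum.decompose 𝒜 ((x : A) * y) m) =
        (x : A) • δ (DirectSum.decompose 𝒜 (y : A) (m - i)) +
          (y : A) • δ (DirectSum.decompose 𝒜 (x : A) (m - j))
      by_cases h : i + j = m
      · subst h
        rw [DirectSum.decompose_of_mem_same 𝒜 (SetLike.GradedMul.mul_mem x.2 y.2),
          add_sub_cancel_left, add_sub_cancel_right, DirectSum.decompose_of_mem_same 𝒜 x.2,
          DirectSum.decompose_of_mem_same 𝒜 y.2, Derivation.leibniz]
      · rw [DirectSum.decompose_of_mem_ne 𝒜 (SetLike.GradedMul.mul_mem x.2 y.2) h,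
          DirectSum.decompose_of_mem_ne 𝒜 x.2 (show i ≠ m - j by omega),
          DirectSum.decompose_of_mem_ne 𝒜 y.2 (show j ≠ m - i by omega)]
        simp)

theorem derivation_apply (δ : Derivation W A M) (y : A) (m : ℤ) :
    derivation 𝒜 δ y m = δ (DirectSum.decompose 𝒜 y m) :=
  rfl

/-- The coordinate at `e` is the sum over `i` of `g_i • δ (y_{e-i})`, where only `i = 0` survives.
The shift module thus isolates degree zero components without a grading on `M`. -/
theorem smul_derivation_apply (δ : Derivation W A M) {e : ℤ} {y : A} (hy : y ∈ 𝒜 e) (g : A) :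
    (g • derivation 𝒜 δ y) e = (DirectSum.decompose 𝒜 g 0 : A) • δ y := by
  induction g using DirectSum.Decomposition.inductionOn 𝒜 with
  | zero => rw [zero_smul, DirectSum.decompose_zero, DirectSum.zero_apply, Submodule.coe_zero,
      zero_smul]; rfl
  | add g g' h h' => rw [add_smul, add_apply, h, h', DirectSum.decompose_add, DirectSum.add_apply,
      Submodule.coe_add, add_smul]
  | @homogeneous i g =>
    rw [smul_apply g.2, derivation_apply]
    by_cases h : i = 0
    · subst h
      rw [sub_zero, DirectSum.decompose_of_mem_same 𝒜 hy, DirectSum.decompose_of_mem_same 𝒜 g.2]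
    · rw [DirectSum.decompose_of_mem_ne 𝒜 g.2 h,
        DirectSum.decompose_of_mem_ne 𝒜 hy (show e ≠ e - i by omega), map_zero, smul_zero,
        zero_smul]

end ShiftModule

open KaehlerDifferential in
/-- If `g` multiplies `Ω` into the submodule spanned by differentials of homogeneous elements, then
so does the degree zero component of `g`. -/
theorem decompose_zero_smul_mem_span [GradedAlgebra 𝒜] {ι : Type*} {a : ι → A} {e : ι → ℤ}
    (ha : ∀ i, a i ∈ 𝒜 (e i))
    {g : A} (hg : ∀ ω : Ω[A⁄W], g • ω ∈ Submodule.span A (Set.range fun i => D W A (a i)))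
    (ω : Ω[A⁄W]) :
    (DirectSum.decompose 𝒜 g 0 : A) • ω ∈ Submodule.span A (Set.range fun i => D W A (a i)) := by
  set N := Submodule.span A (Set.range fun i => D W A (a i)) with hN
  let δ : Derivation W A (Ω[A⁄W] ⧸ N) := N.mkQ.compDer (D W A)
  let ℓ := (ShiftModule.derivation 𝒜 δ).liftKaehlerDifferential
  have hℓ : ∀ y, ℓ (D W A y) = ShiftModule.derivation 𝒜 δ y :=
    (ShiftModule.derivation 𝒜 δ).liftKaehlerDifferential_comp_D
  have hδ : ∀ i, δ (a i) = 0 := fun i =>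
    (Submodule.Quotient.mk_eq_zero N).2 (Submodule.subset_span ⟨i, rfl⟩)
  -- Homogeneity of the `a i` enters here: each of their components is `a i` or zero, and `δ` kills
  -- both.
  have hℓN : ∀ x ∈ N, ℓ x = 0 := by
    intro x hx
    refine Submodule.span_le (p := LinearMap.ker ℓ).2 ?_ hx
    rintro _ ⟨i, rfl⟩
    rw [SetLike.mem_coe, LinearMap.mem_ker, hℓ]
    funext m
    rw [ShiftModule.derivation_apply]
    by_cases h : e i = m
    · subst h
      rw [DirectSum.decompose_of_mem_same 𝒜 (ha i), hδ]
      rfl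
    · rw [DirectSum.decompose_of_mem_ne 𝒜 (ha i) h, map_zero]
      rfl
  -- For `y` of degree `i`, `ℓ` kills `g • D y ∈ N`, and the coordinate of `ℓ (g • D y)` at `i` is
  -- `g_0 • δ y`.
  have key : ∀ y, (DirectSum.decompose 𝒜 g 0 : A) • δ y = 0 := by
    intro y
    induction y using DirectSum.Decomposition.inductionOn 𝒜 with
    | zero => simp
    | add y y' h h' => rw [map_add, smul_add, h, h', add_zero]
    | @homogeneous i y =>
      have h1 := hℓN _ (hg (D W A y))
      rw [map_smul, hℓ] at h1
      rw [← ShiftModule.smul_derivation_apply δ y.2 g, h1]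
      rfl
  have h2 : ω ∈ Submodule.span A (Set.range (D W A)) := by
    rw [span_range_derivation]
    trivial
  induction h2 using Submodule.span_induction with
  | mem x hx =>
    obtain ⟨y, rfl⟩ := hx
    exact (Submodule.Quotient.mk_eq_zero N).1 (key y)
  | zero => rw [smul_zero]; exact zero_mem _
  | add x y _ _ hx hy => rw [smul_add]; exact add_mem hx hy
  | smul c x _ hx => rw [smul_comm]; exact Submodule.smul_mem _ _ hx

end GradedDifferentials

/-! ### Homogeneous étale coordinates -/

section Coordinates

open KaehlerDifferential TensorProduct

/-- The surjection splits, so its kernel is finite projective of rank zero, hence zero. -/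
theorem injective_of_surjective_of_rankAtStalk_eq {R M N : Type*} [CommRing R] [AddCommGroup M]
    [AddCommGroup N] [Module R M] [Module R N] [Module.Finite R M] [Module.Projective R M]
    [Module.Finite R N] [Module.Projective R N]
    (h : Module.rankAtStalk (R := R) M = Module.rankAtStalk (R := R) N) {φ : M →ₗ[R] N}
    (hφ : Function.Surjective φ) : Function.Injective φ := by
  obtain ⟨s, hs⟩ := Module.projective_lifting_property φ LinearMap.id hφ
  have hs' : Function.RightInverse s φ := LinearMap.congr_fun hs
  let r : M →ₗ[R] LinearMap.ker φ := (LinearMap.id - s ∘ₗ φ).codRestrict (LinearMap.ker φ) (by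
    intro x
    simp [hs' (φ x)])
  have hr : ∀ x : LinearMap.ker φ, r x = x := fun x => by
    ext
    simp [r, LinearMap.mem_ker.1 x.2]
  have hr' : r ∘ₗ (LinearMap.ker φ).subtype = LinearMap.id := LinearMap.ext hr
  have : Module.Projective R (LinearMap.ker φ) := .of_split _ r hr'
  have : Module.Finite R (LinearMap.ker φ) :=
    .of_surjective r fun x => ⟨x, hr x⟩
  let e : M ≃ₗ[R] LinearMap.ker φ × N := LinearEquiv.ofBijective (r.prod φ) (by
    constructor
    · rw [injective_iff_map_eq_zero]
      intro x hx
      have h1 : r x = 0 := congrArg Prod.fst hx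
      have h2 : φ x = 0 := congrArg Prod.snd hx
      have h3 := congrArg Subtype.val (hr ⟨x, h2⟩)
      rw [h1] at h3
      exact h3.symm
    · rintro ⟨x, y⟩
      refine ⟨x + s y, Prod.ext ?_ ?_⟩
      · ext
        simp [r, hs' y, LinearMap.mem_ker.1 x.2]
      · simp [hs' y, LinearMap.mem_ker.1 x.2])
  have h1 := Module.rankAtStalk_eq_of_equiv e
  rw [Module.rankAtStalk_prod, h, right_eq_add] at h1
  have : Subsingleton (LinearMap.ker φ) := Module.rankAtStalk_eq_zero_iff_subsingleton.1 h1
  rw [← LinearMap.ker_eq_bot]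
  exact Submodule.eq_bot_of_subsingleton

/-- In the Jacobi–Zariski sequence `H₁(T/R) → H₁(T/S) → T ⊗ Ω_{S/R} → Ω_{T/R} → Ω_{T/S} → 0` the
first term vanishes by formal smoothness. Injectivity of the middle map then kills `H₁(T/S)`, and
surjectivity kills `Ω_{T/S}`. -/
theorem Algebra.FormallyEtale.of_mapBaseChange_bijective {R S T : Type*} [CommRing R] [CommRing S]
    [CommRing T] [Algebra R S] [Algebra R T] [Algebra S T] [IsScalarTower R S T]
    [Algebra.FormallySmooth R T] (h : Function.Bijective (mapBaseChange R S T)) :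
    Algebra.FormallyEtale S T where
  subsingleton_kaehlerDifferential := by
    refine subsingleton_of_forall_eq 0 fun x => ?_
    obtain ⟨y, rfl⟩ := KaehlerDifferential.map_surjective R S T x
    exact ((exact_mapBaseChange_map R S T) y).2 (h.2 y)
  subsingleton_h1Cotangent := by
    refine subsingleton_of_forall_eq 0 fun x => ?_
    have h1 : Algebra.H1Cotangent.δ R S T x = 0 := by
      apply h.1
      rw [map_zero]
      exact (Algebra.H1Cotangent.exact_δ_mapBaseChange R S T _).2 ⟨x, rfl⟩
    obtain ⟨y, rfl⟩ := (Algebra.H1Cotangent.exact_map_δ R S T x).1 h1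
    rw [Subsingleton.elim y 0, map_zero]

variable {W A : Type u} [CommRing W] [CommRing A] [Algebra W A] {d : ℕ}

theorem smooth_of_locally_isStandardSmoothOfRelativeDimension
    (h : RingHom.Locally (RingHom.IsStandardSmoothOfRelativeDimension d) (algebraMap W A)) :
    Algebra.Smooth W A := by
  rw [← RingHom.smooth_algebraMap, RingHom.smooth_iff_locally_isStandardSmooth]
  exact RingHom.locally_of_locally (fun hf => hf.isStandardSmooth) h

/-- The rank is computed on a standard smooth chart containing `q`, where the differentials are free
of rank `d`. -/
theorem rankAtStalk_kaehlerDifferential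
    (h : RingHom.Locally (RingHom.IsStandardSmoothOfRelativeDimension d) (algebraMap W A))
    (q : PrimeSpectrum A) : Module.rankAtStalk (R := A) Ω[A⁄W] q = d := by
  have := smooth_of_locally_isStandardSmoothOfRelativeDimension h
  obtain ⟨s, hs, hd⟩ := h
  obtain ⟨t, ht, htq⟩ : ∃ t ∈ s, t ∉ q.asIdeal := by
    by_contra! hc
    exact q.2.ne_top (top_le_iff.1 (hs ▸ Ideal.span_le.2 hc))
  have h1 := hd t ht
  rw [← IsScalarTower.algebraMap_eq, RingHom.isStandardSmoothOfRelativeDimension_algebraMap] at h1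
  obtain ⟨q', rfl⟩ : q ∈ Set.range (PrimeSpectrum.comap (algebraMap A (Localization.Away t))) := by
    rw [PrimeSpectrum.localization_away_comap_range (Localization.Away t) t]
    exact htq
  have : Algebra.FormallyEtale A (Localization.Away t) := .of_isLocalization (.powers t)
  have : Nontrivial (Localization.Away t) := q'.nontrivial
  have : Algebra.IsStandardSmooth W (Localization.Away t) := h1.isStandardSmooth
  rw [← Module.rankAtStalk_isBaseChange
    (KaehlerDifferential.isBaseChange_of_formallyEtale W A (Localization.Away t)),
    Module.rankAtStalk_eq_finrank_of_free]
  have := Algebra.IsStandardSmoothOfRelativeDimension.rank_kaehlerDifferential (R := W)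
    (S := Localization.Away t) d
  exact Module.finrank_eq_of_rank_eq this

/-- At a prime ideal containing all elements of nonzero degree, finitely many differentials of
homogeneous elements freely generate the differentials at that prime. -/
theorem exists_homogeneous_smul_mem_span (𝒜 : ℤ → Submodule W A) [GradedAlgebra 𝒜]
    (h : RingHom.Locally (RingHom.IsStandardSmoothOfRelativeDimension d) (algebraMap W A))
    (P : Ideal A) [P.IsPrime] (hP : ∀ i ≠ 0, ∀ a ∈ 𝒜 i, a ∈ P) :
    ∃ (a : Fin d → A) (e : Fin d → ℤ) (f : A), (∀ j, a j ∈ 𝒜 (e j)) ∧ f ∈ 𝒜 0 ∧ f ∉ P ∧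
      ∀ ω : Ω[A⁄W], f • ω ∈ Submodule.span A (Set.range fun j => D W A (a j)) := by
  have := smooth_of_locally_isStandardSmoothOfRelativeDimension h
  let L := Localization.AtPrime P
  let l : Ω[A⁄W] →ₗ[A] Ω[L⁄W] := KaehlerDifferential.map W W A L
  have : Algebra.FormallyEtale A L := .of_isLocalization P.primeCompl
  have : Algebra.EssFiniteType W L := Algebra.EssFiniteType.comp W A L
  let v : {a : A // ∃ i, a ∈ 𝒜 i} → Ω[L⁄W] := fun a => l (D W A a.1)
  have hv : Submodule.span L (Set.range v) = ⊤ := by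
    rw [eq_top_iff, ← span_range_map_derivation_of_isLocalization W A L P.primeCompl,
      Submodule.span_le]
    rintro _ ⟨y, rfl⟩
    rw [SetLike.mem_coe, Function.comp_apply]
    induction y using DirectSum.Decomposition.inductionOn 𝒜 with
    | zero => simp
    | @homogeneous i y => exact Submodule.subset_span ⟨⟨y, i, y.2⟩, rfl⟩
    | add y y' hy hy' => rw [map_add, map_add]; exact add_mem hy hy'
  have : Module.FinitePresentation L Ω[L⁄W] :=
    Module.finitePresentation_of_projective L Ω[L⁄W]
  -- Over the local ring `L` the spanning family of differentials of homogeneous elements contains a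
  -- basis.
  obtain ⟨κ, a, b, hb⟩ := Module.exists_basis_of_span_of_flat v hv
  have : Finite κ := Module.Finite.finite_basis b
  have hκ : Nat.card κ = d := by
    rw [← Module.finrank_eq_nat_card_basis b, ← rankAtStalk_kaehlerDifferential h ⟨P, ‹_›⟩]
    have h1 := Module.rankAtStalk_isBaseChange
      (KaehlerDifferential.isBaseChange_of_formallyEtale W A L) (IsLocalRing.closedPoint L)
    have : Module.Free L Ω[L⁄W] := Module.Free.of_basis b
    rw [Module.rankAtStalk_eq_finrank_of_free] at h1
    refine h1.trans (congrArg _ (PrimeSpectrum.ext ?_))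
    exact IsLocalization.AtPrime.under_maximalIdeal L P
  let ε : Fin d ≃ κ := (Finite.equivFinOfCardEq hκ).symm
  choose e he using fun j => (a (ε j)).2
  set N := Submodule.span A (Set.range fun j => D W A (a (ε j)).1) with hN
  have hN' : N.localized' L P.primeCompl l = ⊤ := by
    rw [hN, Submodule.localized'_span, eq_top_iff, ← b.span_eq, Submodule.span_le]
    rintro _ ⟨i, rfl⟩
    refine Submodule.subset_span ⟨_, ⟨ε.symm i, rfl⟩, ?_⟩
    simp [hb, v]
  have hC : (⟨P, ‹_›⟩ : PrimeSpectrum A) ∉ Module.support A (Ω[A⁄W] ⧸ N) := by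
    rw [Module.notMem_support_iff']
    intro x
    obtain ⟨x, rfl⟩ := N.mkQ_surjective x
    have hx : l x ∈ N.localized' L P.primeCompl l := hN' ▸ Submodule.mem_top
    obtain ⟨m, hm, s, hs⟩ := hx
    rw [IsLocalizedModule.mk'_eq_iff, Submonoid.smul_def, ← map_smul,
      IsLocalizedModule.eq_iff_exists P.primeCompl] at hs
    obtain ⟨c, hc⟩ := hs
    refine ⟨c * s, (c * s).2, ?_⟩
    rw [← map_smul, Submodule.mkQ_apply, Submodule.Quotient.mk_eq_zero, mul_smul]
    rw [Submonoid.smul_def, Submonoid.smul_def] at hc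
    rw [← hc]
    exact N.smul_mem _ hm
  -- The support of the finite module `Ω/N` is the zero set of its annihilator, so a single `g ∉ P`
  -- kills the whole quotient.
  rw [Module.mem_support_iff_of_finite, SetLike.not_le_iff_exists] at hC
  obtain ⟨g, hg, hgP⟩ := hC
  rw [Module.mem_annihilator] at hg
  refine ⟨fun j => (a (ε j)).1, e, DirectSum.decompose 𝒜 g 0, he, SetLike.coe_mem _, ?_, ?_⟩
  -- All components of `g` of nonzero degree lie in `P` by `hP`, so `g_0 ∈ P` would force `g ∈ P`.
  · intro h0
    apply hgP
    classical
    change g ∈ P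
    rw [← DirectSum.sum_support_decompose 𝒜 g]
    refine sum_mem fun i _ => ?_
    by_cases hi : i = 0
    · subst hi
      exact h0
    · exact hP i hi _ (SetLike.coe_mem _)
  · refine decompose_zero_smul_mem_span 𝒜 he fun ω => ?_
    rw [← Submodule.Quotient.mk_eq_zero, ← Submodule.mkQ_apply, map_smul]
    exact hg _

/-- If the differentials of `a_1, …, a_d` span all differentials after inverting `f`, for `A` smooth
of relative dimension `d`, then `a_1, …, a_d` define an étale map on the locus where `f` is
invertible. -/
theorem formallyEtale_aeval_of_smul_mem_span
    (h : RingHom.Locally (RingHom.IsStandardSmoothOfRelativeDimension d) (algebraMap W A))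
    {a : Fin d → A} {f : A}
    (hf : ∀ ω : Ω[A⁄W], f • ω ∈ Submodule.span A (Set.range fun j => D W A (a j))) :
    ((algebraMap A (Localization.Away f)).comp
      (MvPolynomial.aeval (R := W) a).toRingHom).FormallyEtale := by
  have := smooth_of_locally_isStandardSmoothOfRelativeDimension h
  let L := Localization.Away f
  let Q := MvPolynomial (Fin d) W
  have : Algebra.FormallyEtale A L := .of_isLocalization (.powers f)
  have : Algebra.FormallySmooth W L := .comp W A L
  let φ : Q →ₐ[W] L := (IsScalarTower.toAlgHom W A L).comp (MvPolynomial.aeval a)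
  change φ.toRingHom.FormallyEtale
  algebraize [φ.toRingHom]
  have : IsScalarTower W Q L := .of_algebraMap_eq' φ.comp_algebraMap.symm
  have hbc := KaehlerDifferential.isBaseChange_of_formallyEtale W A L
  have : Module.Finite L Ω[L⁄W] := .equiv hbc.equiv
  apply Algebra.FormallyEtale.of_mapBaseChange_bijective (R := W)
  have hsurj : Function.Surjective (mapBaseChange W Q L) := by
    rw [← LinearMap.range_eq_top, eq_top_iff,
      ← span_range_map_derivation_of_isLocalization W A L (.powers f), Submodule.span_le]
    rintro _ ⟨y, rfl⟩
    rw [SetLike.mem_coe, Function.comp_apply]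
    have h1 : ∀ ω ∈ Submodule.span A (Set.range fun j => D W A (a j)),
        KaehlerDifferential.map W W A L ω ∈ LinearMap.range (mapBaseChange W Q L) := by
      intro ω hω
      induction hω using Submodule.span_induction with
      | mem x hx =>
        obtain ⟨j, rfl⟩ := hx
        refine ⟨1 ⊗ₜ D W Q (MvPolynomial.X j), ?_⟩
        rw [mapBaseChange_tmul, one_smul, map_D, map_D]
        congr 1
        exact congrArg (algebraMap A L) (MvPolynomial.aeval_X a j)
      | zero => simp
      | add x y _ _ hx hy => rw [map_add]; exact add_mem hx hy
      | smul c x _ hx =>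
        rw [map_smul, ← algebraMap_smul L]
        exact Submodule.smul_mem _ _ hx
    have h2 := h1 _ (hf (D W A y))
    rw [map_smul, ← algebraMap_smul L] at h2
    have hu : IsUnit (algebraMap A L f) := IsLocalization.Away.algebraMap_isUnit f
    exact (Submodule.smul_mem_iff_of_isUnit _ hu).1 h2
  -- Both modules have constant rank `d`: the source is free on the `dX_j`, and the target is the
  -- base change of `Ω[A⁄W]`.
  refine ⟨injective_of_surjective_of_rankAtStalk_eq ?_ hsurj, hsurj⟩
  ext q
  have := q.nontrivial
  rw [Module.rankAtStalk_isBaseChange hbc, rankAtStalk_kaehlerDifferential h,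
    Module.rankAtStalk_eq_finrank_of_free, Pi.natCast_apply, Nat.cast_id]
  exact (Module.finrank_eq_card_basis ((mvPolynomialBasis W (Fin d)).baseChange L)).trans
    (Fintype.card_fin d)

end Coordinates

/-! ### Infinitesimal lifting for formally étale ring homomorphisms -/

section Lifting

theorem isUnit_of_isUnit_map_of_ker_sq {S S' : Type*} [CommRing S] [CommRing S'] {π : S →+* S'}
    (hπ : Function.Surjective π) (hker : RingHom.ker π ^ 2 = ⊥) {x : S} (hx : IsUnit (π x)) :
    IsUnit x := by
  obtain ⟨y', hy⟩ := hx.exists_right_inv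
  obtain ⟨y, rfl⟩ := hπ y'
  have h1 : x * y - 1 ∈ RingHom.ker π := by
    rw [RingHom.mem_ker, map_sub, map_mul, hy, map_one, sub_self]
  have h2 : IsNilpotent (x * y - 1) := ⟨2, by
    rw [← Ideal.mem_bot, ← hker]
    exact Ideal.pow_mem_pow h1 2⟩
  have h3 := h2.isUnit_add_one
  rw [sub_add_cancel] at h3
  exact isUnit_of_mul_isUnit_left h3

theorem RingHom.FormallyEtale.exists_lift {Q L S S' : Type*} [CommRing Q] [CommRing L] [CommRing S]
    [CommRing S'] {φ : Q →+* L} (hφ : φ.FormallyEtale) {π : S →+* S'} (hπ : Function.Surjective π)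
    (hker : RingHom.ker π ^ 2 = ⊥) {α : Q →+* S} {β : L →+* S'} (h : π.comp α = β.comp φ) :
    ∃ γ : L →+* S, γ.comp φ = α ∧ π.comp γ = β := by
  algebraize [φ, α, π.comp α]
  let β' : L →ₐ[Q] S' := { β with commutes' := fun x => (RingHom.congr_fun h x).symm }
  let π' : S →ₐ[Q] S' := { π with commutes' := fun x => rfl }
  have hker' : IsNilpotent (RingHom.ker (π' : S →+* S')) := ⟨2, hker⟩
  refine ⟨(Algebra.FormallySmooth.liftOfSurjective β' π' hπ hker').toRingHom, ?_, ?_⟩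
  · ext x
    exact (Algebra.FormallySmooth.liftOfSurjective β' π' hπ hker').commutes x
  · ext x
    exact Algebra.FormallySmooth.liftOfSurjective_apply β' π' hπ hker' x

theorem RingHom.FormallyEtale.hom_ext {Q L S S' : Type*} [CommRing Q] [CommRing L] [CommRing S]
    [CommRing S'] {φ : Q →+* L} (hφ : φ.FormallyEtale) {π : S →+* S'}
    (hker : RingHom.ker π ^ 2 = ⊥) {γ γ' : L →+* S} (h : γ.comp φ = γ'.comp φ)
    (h' : π.comp γ = π.comp γ') : γ = γ' := by
  algebraize [φ, γ.comp φ]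
  let γ₁ : L →ₐ[Q] S := { γ with commutes' := fun x => rfl }
  let γ₂ : L →ₐ[Q] S := { γ' with commutes' := fun x => (RingHom.congr_fun h x).symm }
  have := Algebra.FormallyUnramified.ext' π ⟨2, hker⟩ γ₁ γ₂ (RingHom.congr_fun h')
  exact congrArg AlgHom.toRingHom this

/-- The infinitesimal criterion in terms of bare ring homomorphisms, which leaves the choice of
algebra structures on the test ring to each application. -/
theorem RingHom.FormallyEtale.of_forall_lift {Q L : Type u} [CommRing Q] [CommRing L] {φ : Q →+* L}
    (hex : ∀ (S : Type u) [CommRing S] (I : Ideal S), I ^ 2 = ⊥ → ∀ (α : Q →+* S)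
      (β : L →+* S ⧸ I), (Ideal.Quotient.mk I).comp α = β.comp φ →
      ∃ γ : L →+* S, γ.comp φ = α ∧ (Ideal.Quotient.mk I).comp γ = β)
    (huniq : ∀ (S : Type u) [CommRing S] (I : Ideal S), I ^ 2 = ⊥ → ∀ γ γ' : L →+* S,
      γ.comp φ = γ'.comp φ → (Ideal.Quotient.mk I).comp γ = (Ideal.Quotient.mk I).comp γ' →
      γ = γ') : φ.FormallyEtale := by
  algebraize [φ]
  change Algebra.FormallyEtale Q L
  rw [Algebra.FormallyEtale.iff_comp_bijective]
  intro S _ _ I hI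
  refine ⟨fun γ γ' h => ?_, fun β => ?_⟩
  · have := huniq S I hI γ.toRingHom γ'.toRingHom
      (γ.comp_algebraMap.trans γ'.comp_algebraMap.symm) (congrArg AlgHom.toRingHom h)
    exact AlgHom.coe_ringHom_injective this
  · obtain ⟨γ, h1, h2⟩ := hex S I hI (algebraMap Q S) β.toRingHom β.comp_algebraMap.symm
    exact ⟨{ γ with commutes' := RingHom.congr_fun h1 }, AlgHom.ext (RingHom.congr_fun h2)⟩

variable {W A S S' : Type*} [CommRing W] [CommRing A] [Algebra W A] [CommRing S] [Algebra W S]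
  [CommRing S'] [Algebra W S'] {d : ℕ} {a : Fin d → A} {f : A}

/-- Lifting along square-zero extensions, with prescribed values on étale coordinates. -/
theorem exists_algHom_lift_of_formallyEtale
    (hE : ((algebraMap A (Localization.Away f)).comp
      (MvPolynomial.aeval (R := W) a).toRingHom).FormallyEtale)
    {π : S →ₐ[W] S'} (hπ : Function.Surjective π) (hker : RingHom.ker π ^ 2 = ⊥)
    {φ : A →ₐ[W] S'} (hφ : IsUnit (φ f)) {s : Fin d → S} (hs : ∀ j, π (s j) = φ (a j)) :
    ∃ ψ : A →ₐ[W] S, π.comp ψ = φ ∧ ∀ j, ψ (a j) = s j := by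
  -- As `φ f` is a unit, `φ` extends to `A_f`. The `s j` give the other side of the square to which
  -- the étale map `W[X] → A_f` is applied.
  have h0 : π.toRingHom.comp (MvPolynomial.aeval (R := W) s).toRingHom =
      (IsLocalization.Away.lift (S := Localization.Away f) f (g := φ.toRingHom) hφ).comp
        ((algebraMap A (Localization.Away f)).comp
          (MvPolynomial.aeval (R := W) a).toRingHom) := by
    rw [← RingHom.comp_assoc, IsLocalization.Away.lift_comp]
    have : π.comp (MvPolynomial.aeval (R := W) s) = φ.comp (MvPolynomial.aeval (R := W) a) :=
      MvPolynomial.algHom_ext fun j => by simp [hs]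
    exact congrArg AlgHom.toRingHom this
  obtain ⟨γ, h1, h2⟩ := hE.exists_lift (π := π.toRingHom) hπ hker h0
  have h1' : ∀ x, γ (algebraMap A _ (MvPolynomial.aeval (R := W) a x)) =
      MvPolynomial.aeval (R := W) s x := RingHom.congr_fun h1
  refine ⟨{ γ.comp (algebraMap A (Localization.Away f)) with
    commutes' := fun w => ?_ }, AlgHom.ext fun x => ?_, fun j => ?_⟩
  · simpa using h1' (MvPolynomial.C w)
  · have h3 := RingHom.congr_fun h2 (algebraMap A _ x)
    rw [IsLocalization.Away.lift_eq] at h3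
    exact h3
  · simpa using h1' (MvPolynomial.X j)

/-- Units lift along square-zero surjections, so both maps extend to `A_f`, where infinitesimal
uniqueness over `W[X]` applies. -/
theorem algHom_ext_of_formallyEtale
    (hE : ((algebraMap A (Localization.Away f)).comp
      (MvPolynomial.aeval (R := W) a).toRingHom).FormallyEtale)
    {π : S →ₐ[W] S'} (hπ : Function.Surjective π) (hker : RingHom.ker π ^ 2 = ⊥)
    {ψ ψ' : A →ₐ[W] S} (hψ : IsUnit (π (ψ f))) (h : π.comp ψ = π.comp ψ')
    (ha : ∀ j, ψ (a j) = ψ' (a j)) : ψ = ψ' := by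
  have hu : IsUnit (ψ f) := isUnit_of_isUnit_map_of_ker_sq (π := π.toRingHom) hπ hker hψ
  have hu' : IsUnit (ψ' f) := isUnit_of_isUnit_map_of_ker_sq (π := π.toRingHom) hπ hker
    (by rwa [show π (ψ f) = π (ψ' f) from AlgHom.congr_fun h f] at hψ)
  let γ := IsLocalization.Away.lift (S := Localization.Away f) f (g := ψ.toRingHom) hu
  let γ' := IsLocalization.Away.lift (S := Localization.Away f) f (g := ψ'.toRingHom) hu'
  have hγ : γ.comp (algebraMap A _) = ψ.toRingHom := IsLocalization.Away.lift_comp f hu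
  have hγ' : γ'.comp (algebraMap A _) = ψ'.toRingHom := IsLocalization.Away.lift_comp f hu'
  have key : γ = γ' := by
    refine hE.hom_ext (π := π.toRingHom) hker ?_ ?_
    · rw [← RingHom.comp_assoc, ← RingHom.comp_assoc, hγ, hγ']
      have : ψ.comp (MvPolynomial.aeval (R := W) a) = ψ'.comp (MvPolynomial.aeval (R := W) a) :=
        MvPolynomial.algHom_ext fun j => by simp [ha]
      exact congrArg AlgHom.toRingHom this
    · refine IsLocalization.ringHom_ext (.powers f) ?_
      rw [RingHom.comp_assoc, RingHom.comp_assoc, hγ, hγ']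
      exact congrArg AlgHom.toRingHom h
  refine AlgHom.coe_ringHom_injective ?_
  change ψ.toRingHom = ψ'.toRingHom
  rw [← hγ, ← hγ', key]

end Lifting

/-! ### Representability of the functor of graded points -/

section HomogeneousGenerators

variable {W A S : Type*} [CommRing W] [CommRing A] [Algebra W A] [CommRing S] [Algebra W S]
  (𝒜 : ℤ → Submodule W A) [GradedAlgebra 𝒜] (𝒮 : ℤ → Submodule W S) [GradedAlgebra 𝒮]

/-- The homogeneous components of finitely many generators again generate. -/
theorem exists_homogeneous_generators [Algebra.FiniteType W A] :
    ∃ (r : ℕ) (y : Fin r → A) (e : Fin r → ℤ), (∀ j, y j ∈ 𝒜 (e j)) ∧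
      Algebra.adjoin W (Set.range y) = ⊤ := by
  classical
  obtain ⟨F, hF⟩ := Algebra.FiniteType.out (R := W) (A := A)
  let T : Finset A := F.biUnion fun x => (DirectSum.decompose 𝒜 x).support.image
    fun i => (DirectSum.decompose 𝒜 x i : A)
  have hT : ∀ t : T, ∃ i, (t : A) ∈ 𝒜 i := by
    rintro ⟨t, ht⟩
    simp only [T, Finset.mem_biUnion, Finset.mem_image] at ht
    obtain ⟨x, -, i, -, rfl⟩ := ht
    exact ⟨i, SetLike.coe_mem _⟩
  choose e he using hT
  refine ⟨T.card, fun j => (T.equivFin.symm j).1, fun j => e (T.equivFin.symm j),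
    fun j => he _, ?_⟩
  rw [eq_top_iff, ← hF, Algebra.adjoin_le_iff]
  intro x hx
  rw [SetLike.mem_coe, ← DirectSum.sum_support_decompose 𝒜 x]
  refine sum_mem fun i hi => Algebra.subset_adjoin ?_
  have hmem : (DirectSum.decompose 𝒜 x i : A) ∈ T :=
    Finset.mem_biUnion.2 ⟨x, hx, Finset.mem_image_of_mem _ hi⟩
  exact ⟨T.equivFin ⟨_, hmem⟩, by simp⟩

/-- A homomorphism of algebras is graded if it preserves the degrees of homogeneous generators. -/
theorem algHom_mem_of_generators {r : ℕ} {y : Fin r → A} {e : Fin r → ℤ} (hy : ∀ j, y j ∈ 𝒜 (e j))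
    (hgen : Algebra.adjoin W (Set.range y) = ⊤) {φ : A →ₐ[W] S} (hφ : ∀ j, φ (y j) ∈ 𝒮 (e j))
    {i : ℤ} {a : A} (ha : a ∈ 𝒜 i) : φ a ∈ 𝒮 i := by
  -- Monomials in the generators are homogeneous with image of the same degree, and they span `A`.
  -- So `φ` commutes with taking components.
  have h1 : ∀ x ∈ Submonoid.closure (Set.range y), ∃ i, x ∈ 𝒜 i ∧ φ x ∈ 𝒮 i := by
    intro x hx
    induction hx using Submonoid.closure_induction with
    | mem x hx =>
      obtain ⟨j, rfl⟩ := hx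
      exact ⟨e j, hy j, hφ j⟩
    | one => exact ⟨0, SetLike.GradedOne.one_mem, by
        rw [map_one]; exact SetLike.GradedOne.one_mem⟩
    | mul x x' _ _ hx hx' =>
      obtain ⟨i, h, h'⟩ := hx
      obtain ⟨j, g, g'⟩ := hx'
      exact ⟨i + j, SetLike.GradedMul.mul_mem h g, by
        rw [map_mul]; exact SetLike.GradedMul.mul_mem h' g'⟩
  have h2 : a ∈ Submodule.span W (Submonoid.closure (Set.range y) : Set A) := by
    rw [← Algebra.adjoin_eq_span, hgen]
    trivial
  have h3 : φ (DirectSum.decompose 𝒜 a i) = DirectSum.decompose 𝒮 (φ a) i := by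
    clear ha
    induction h2 using Submodule.span_induction with
    | mem x hx =>
      obtain ⟨j, h, h'⟩ := h1 x hx
      by_cases hij : j = i
      · subst hij
        rw [DirectSum.decompose_of_mem_same 𝒜 h, DirectSum.decompose_of_mem_same 𝒮 h']
      · rw [DirectSum.decompose_of_mem_ne 𝒜 h hij, DirectSum.decompose_of_mem_ne 𝒮 h' hij,
          map_zero]
    | zero => simp
    | add x x' _ _ hx hx' => simp [DirectSum.decompose_add, hx, hx']
    | smul w x _ hx =>
      rw [DirectSum.decompose_smul, map_smul, DirectSum.decompose_smul, DirectSum.smul_apply,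
        DirectSum.smul_apply, Submodule.coe_smul, Submodule.coe_smul, map_smul, hx]
  rw [DirectSum.decompose_of_mem_same 𝒜 ha] at h3
  rw [h3]
  exact SetLike.coe_mem _

end HomogeneousGenerators

/-! ### Generic tuples of Witt vectors and ideals of coefficients. -/

namespace TruncWittFrame

variable {p : ℕ} [Fact p.Prime] {n : ℕ} {k : Type u} [Field k] [CharP k p]

/-- The evaluation of polynomials at homogeneous elements of degrees `e` of the truncated Witt
frame. -/
noncomputable def evalHom {r : ℕ} (e : Fin r → ℤ) {R : Type*} [CommRing R] [Algebra k R]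
    (s : Fin r → TruncatedWittVector p n R) :
    MvPolynomial (Fin r) (WittVector p k) →ₐ[WittVector p k] TruncWittFrame p n k R :=
  MvPolynomial.aeval fun j => incl p n k R (e j) (s j)

theorem map_comp_evalHom {r : ℕ} (e : Fin r → ℤ) {R R' : Type*} [CommRing R] [Algebra k R]
    [CommRing R'] [Algebra k R'] (g : R →ₐ[k] R') (s : Fin r → TruncatedWittVector p n R) :
    (map g).comp (evalHom e s) = evalHom e fun j => TruncWitt.map g.toRingHom (s j) := by
  refine MvPolynomial.algHom_ext fun j => ?_
  rw [AlgHom.comp_apply, evalHom, evalHom, MvPolynomial.aeval_X, MvPolynomial.aeval_X, map_incl]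

section

variable (p : ℕ) [Fact p.Prime] (n : ℕ) (k : Type u) [Field k]

/-- The generic Witt vectors of length `n`. -/
noncomputable def generic {r : ℕ} (j : Fin r) :
    TruncatedWittVector p n (MvPolynomial (Fin r × Fin n) k) :=
  TruncatedWittVector.mk p fun m => MvPolynomial.X (j, m)

theorem map_generic {r : ℕ} {R : Type*} [CommRing R] [Algebra k R]
    (s : Fin r → TruncatedWittVector p n R) (j : Fin r) :
    TruncWitt.map (MvPolynomial.aeval (R := k) fun x : Fin r × Fin n =>
      (s x.1).coeff x.2).toRingHom (generic p n k j) = s j := by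
  refine TruncatedWittVector.ext fun m => ?_
  rw [TruncWitt.coeff_map, generic, TruncatedWittVector.coeff_mk]
  exact MvPolynomial.aeval_X _ _

end

/-- The ideal of the coefficients of a set of elements of the truncated Witt frame. -/
noncomputable def coeffIdeal {R : Type*} [CommRing R] [Algebra k R]
    (T : Set (TruncWittFrame p n k R)) : Ideal R :=
  Ideal.span {c | ∃ x ∈ T, ∃ i m, c = (coord p n k R i x).coeff m}

/-- `map g` acts coefficientwise, so `coeffIdeal T` cuts out the locus where the elements of `T`
vanish. -/
theorem coeffIdeal_le_ker_iff {R R' : Type*} [CommRing R] [Algebra k R] [CommRing R']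
    [Algebra k R'] (g : R →ₐ[k] R') (T : Set (TruncWittFrame p n k R)) :
    coeffIdeal T ≤ RingHom.ker g ↔ ∀ x ∈ T, map g x = 0 := by
  rw [coeffIdeal, Ideal.span_le]
  constructor
  · intro h x hx
    refine ext_coord fun i => TruncatedWittVector.ext fun m => ?_
    rw [coord_map, TruncWitt.coeff_map, map_zero, TruncatedWittVector.coeff_zero]
    exact h ⟨x, hx, i, m, rfl⟩
  · rintro h _ ⟨x, hx, i, m, rfl⟩
    have h1 := congrArg (TruncatedWittVector.coeff m) (congrArg (coord p n k R' i) (h x hx))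
    rw [coord_map, TruncWitt.coeff_map, map_zero, TruncatedWittVector.coeff_zero] at h1
    exact h1

end TruncWittFrame

section Representability

open TruncWittFrame

variable {p : ℕ} [Fact p.Prime] {k : Type u} [Field k] [CharP k p] {A : Type u} [CommRing A]
  [Algebra (WittVector p k) A] (𝒜 : ℤ → Submodule (WittVector p k) A)

/-- The representing algebra is the polynomial ring in the Witt coefficients of the values at
homogeneous generators, modulo the coefficients of all relations evaluated at the generic tuple. -/
theorem exists_corepresentableBy [GradedAlgebra 𝒜] [Algebra.FiniteType (WittVector p k) A]
    (n : ℕ) : ∃ B : CommAlgCat.{u} k, Algebra.FiniteType k B ∧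
      Nonempty ((gradedPointsFunctor p 𝒜 n).CorepresentableBy B) := by
  obtain ⟨r, y, e, hy, hgen⟩ := exists_homogeneous_generators 𝒜
  let ev : MvPolynomial (Fin r) (WittVector p k) →ₐ[WittVector p k] A := MvPolynomial.aeval y
  have hev : Function.Surjective ev := by
    rw [← AlgHom.range_eq_top, ← hgen, ← Algebra.adjoin_range_eq_range_aeval]
  let P := MvPolynomial (Fin r × Fin n) k
  let J : Ideal P := coeffIdeal (evalHom (k := k) e (generic p n k) '' (RingHom.ker ev))
  let q : P →ₐ[k] P ⧸ J := Ideal.Quotient.mkₐ k J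
  have hq : Function.Surjective q := Ideal.Quotient.mkₐ_surjective k J
  have hext : ∀ {R : Type u} [CommRing R] [Algebra k R]
      (φ ψ : A →ₐ[WittVector p k] TruncWittFrame p n k R), (∀ j, φ (y j) = ψ (y j)) → φ = ψ :=
    fun φ ψ h => AlgHom.ext_of_adjoin_eq_top hgen (by rintro _ ⟨j, rfl⟩; exact h j)
  let s : Fin r → TruncatedWittVector p n (P ⧸ J) :=
    fun j => TruncWitt.map q.toRingHom (generic p n k j)
  have hsc : ∀ x : Fin r × Fin n, (s x.1).coeff x.2 = q (MvPolynomial.X x) := by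
    intro x
    rw [TruncWitt.coeff_map, generic, TruncatedWittVector.coeff_mk]
    rfl
  have hs : (TruncWittFrame.map q).comp (evalHom e (generic p n k)) = evalHom e s :=
    map_comp_evalHom e q _
  -- Modulo `J` the generic tuple satisfies every relation of `A`, so it defines the universal point
  -- `u`.
  have hker : RingHom.ker ev.toRingHom ≤ RingHom.ker (evalHom (k := k) e s).toRingHom := by
    intro x hx
    have := (coeffIdeal_le_ker_iff q _).1 (Ideal.mk_ker (I := J)).ge _ ⟨x, hx, rfl⟩
    exact (AlgHom.congr_fun hs x).symm.trans this
  let u := AlgHom.liftOfSurjective ev hev (evalHom e s) hker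
  have hu : ∀ j, u (y j) = incl p n k (P ⧸ J) (e j) (s j) := by
    intro j
    have h1 : y j = ev (MvPolynomial.X j) := (MvPolynomial.aeval_X _ _).symm
    rw [h1, AlgHom.liftOfSurjective_apply]
    exact MvPolynomial.aeval_X _ _
  let U : GradedPoints p 𝒜 n (P ⧸ J) := ⟨u, fun i a ha =>
    algHom_mem_of_generators 𝒜 (grading p n k (P ⧸ J)) hy hgen
      (fun j => ⟨s j, (hu j).symm⟩) ha⟩
  let B : CommAlgCat.{u} k := CommAlgCat.of k (P ⧸ J)
  have hbij : ∀ R : CommAlgCat.{u} k, Function.Bijective fun g : B ⟶ R =>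
      (show GradedPoints p 𝒜 n R from (gradedPointsFunctor p 𝒜 n).map g U) := by
    intro R
    constructor
    · intro g g' h
      have h1 : ∀ j, TruncWitt.map g.hom.toRingHom (s j) =
          TruncWitt.map g'.hom.toRingHom (s j) := by
        intro j
        have h2 : TruncWittFrame.map g.hom (u (y j)) = TruncWittFrame.map g'.hom (u (y j)) :=
          AlgHom.congr_fun (congrArg Subtype.val h) (y j)
        rw [hu, map_incl, map_incl] at h2
        exact incl_injective _ h2
      apply CommAlgCat.hom_ext
      have h3 : g.hom.comp q = g'.hom.comp q := by
        refine MvPolynomial.algHom_ext fun x => ?_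
        have h4 := congrArg (TruncatedWittVector.coeff x.2) (h1 x.1)
        rwa [TruncWitt.coeff_map _ (s x.1), TruncWitt.coeff_map _ (s x.1), hsc] at h4
      exact AlgHom.ext fun b => by
        obtain ⟨b, rfl⟩ := hq b
        exact AlgHom.congr_fun h3 b
    · intro φ
      let c : Fin r → TruncatedWittVector p n R := fun j => coord p n k R (e j) (φ.1 (y j))
      have hc : ∀ j, incl p n k R (e j) (c j) = φ.1 (y j) := fun j =>
        incl_coord_of_mem (φ.2 (e j) (y j) (hy j))
      let g : P →ₐ[k] R := MvPolynomial.aeval fun x => (c x.1).coeff x.2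
      have hg : ∀ j, TruncWitt.map g.toRingHom (generic p n k j) = c j :=
        map_generic p n k c
      have h1 : (TruncWittFrame.map g).comp (evalHom e (generic p n k)) = φ.1.comp ev := by
        rw [map_comp_evalHom]
        refine MvPolynomial.algHom_ext fun j => ?_
        rw [evalHom, MvPolynomial.aeval_X, hg, hc, AlgHom.comp_apply]
        exact congrArg _ (MvPolynomial.aeval_X _ _).symm
      -- The tuple `c` comes from a homomorphism out of `A`, so it satisfies all relations.
      have hJ : J ≤ RingHom.ker g := by
        rw [coeffIdeal_le_ker_iff]
        rintro _ ⟨x, hx, rfl⟩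
        refine (AlgHom.congr_fun h1 x).trans ?_
        rw [AlgHom.comp_apply, RingHom.mem_ker.1 hx, map_zero]
      refine ⟨CommAlgCat.ofHom (Ideal.Quotient.liftₐ J g fun a ha => hJ ha), ?_⟩
      refine Subtype.ext (hext _ _ fun j => ?_)
      change TruncWittFrame.map (Ideal.Quotient.liftₐ J g fun a ha => hJ ha) (u (y j)) = _
      rw [hu, map_incl, ← hc, ← hg, TruncWitt.map_map]
      rfl
  refine ⟨B, Algebra.FiniteType.of_surjective q hq, ⟨⟨fun {R} => Equiv.ofBijective _ (hbij R),
    fun {R R'} g f => ?_⟩⟩⟩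
  exact Subtype.ext (AlgHom.ext fun a => (TruncWittFrame.map_map f.hom g.hom _).symm)

end Representability

/-! ### Étale coordinates on the representing algebras -/

section UniversalPoint

open TruncWittFrame

variable {p : ℕ} [Fact p.Prime] {k : Type u} [Field k] [CharP k p] {A : Type u} [CommRing A]
  [Algebra (WittVector p k) A] {𝒜 : ℤ → Submodule (WittVector p k) A} {n : ℕ}

/-- A graded point `U` over `B` is universal if every graded point over a `k`-algebra `R` is the
image of `U` under a unique homomorphism `B → R`. -/
structure GradedPoints.IsUniversal {B : Type u} [CommRing B] [Algebra k B]
    (U : GradedPoints p 𝒜 n B) : Prop where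
  exists_map_comp_eq : ∀ {R : Type u} [CommRing R] [Algebra k R] (φ : GradedPoints p 𝒜 n R),
    ∃ g : B →ₐ[k] R, (TruncWittFrame.map g).comp U.1 = φ.1
  hom_ext : ∀ {R : Type u} [CommRing R] [Algebra k R] {g g' : B →ₐ[k] R},
    (TruncWittFrame.map g).comp U.1 = (TruncWittFrame.map g').comp U.1 → g = g'

/-- The universal graded point over a representing algebra. -/
noncomputable def universalPoint {B : CommAlgCat.{u} k}
    (h : (gradedPointsFunctor p 𝒜 n).CorepresentableBy B) : GradedPoints p 𝒜 n B :=
  h.homEquiv (𝟙 B)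

theorem universalPoint_isUniversal {B : CommAlgCat.{u} k}
    (h : (gradedPointsFunctor p 𝒜 n).CorepresentableBy B) : (universalPoint h).IsUniversal where
  exists_map_comp_eq {R} _ _ φ := by
    obtain ⟨g, hg⟩ := h.homEquiv.surjective
      (show (gradedPointsFunctor p 𝒜 n).obj (CommAlgCat.of k R) from φ)
    rw [h.homEquiv_eq] at hg
    exact ⟨g.hom, congrArg Subtype.val hg⟩
  hom_ext {R} _ _ g g' hgg := by
    have h1 : CommAlgCat.ofHom g = CommAlgCat.ofHom g' := by
      apply h.homEquiv.injective
      rw [h.homEquiv_eq, h.homEquiv_eq (CommAlgCat.ofHom g')]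
      exact Subtype.ext hgg
    exact congrArg CommAlgCat.Hom.hom h1

/-- The Yoneda description of the reduction map: it pulls the universal point of level `n` back to
the reduction of that of level `n + 1`. -/
theorem map_representingHom_comp_universalPoint {B B' : CommAlgCat.{u} k}
    (h : (gradedPointsFunctor p 𝒜 n).CorepresentableBy B)
    (h' : (gradedPointsFunctor p 𝒜 (n + 1)).CorepresentableBy B') :
    (TruncWittFrame.map (representingHom (gradedPointsReduction p 𝒜 n) h h').hom).comp
      (universalPoint h).1 = (reduction n.le_succ B').comp (universalPoint h').1 := by
  have h1 : (gradedPointsFunctor p 𝒜 n).map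
      (representingHom (gradedPointsReduction p 𝒜 n) h h') (h.homEquiv (𝟙 B)) =
      (gradedPointsReduction p 𝒜 n).app B' (h'.homEquiv (𝟙 B')) := by
    rw [← h.homEquiv_eq, representingHom, Equiv.apply_symm_apply]
  exact congrArg Subtype.val h1

variable {B : Type u} [CommRing B] [Algebra k B] {U : GradedPoints p 𝒜 n B}

theorem TruncWittFrame.coord_reduction {R : Type*} [CommRing R] [Algebra k R] (i : ℤ)
    (x : TruncWittFrame p (n + 1) k R) :
    coord p n k R i (reduction n.le_succ R x) =
      TruncatedWittVector.truncate n.le_succ (coord p (n + 1) k R i x) :=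
  coord_mapRingHom (TruncWitt.truncate_versch _) (TruncWitt.truncate_frob _ _) i x

/-- The Witt coefficients of the values of a graded point at elements of `A` of degrees `e`. -/
noncomputable def GradedPoints.wittCoords {d : ℕ} (U : GradedPoints p 𝒜 n B) (a : Fin d → A)
    (e : Fin d → ℤ) : MvPolynomial (Fin d × Fin n) k →ₐ[k] B :=
  MvPolynomial.aeval fun x => (coord p n k B (e x.1) (U.1 (a x.1))).coeff x.2

theorem GradedPoints.map_apply_eq_incl {d : ℕ} (U : GradedPoints p 𝒜 n B) {a : Fin d → A}
    {e : Fin d → ℤ} (ha : ∀ j, a j ∈ 𝒜 (e j)) {R : Type u} [CommRing R] [Algebra k R]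
    (g : B →ₐ[k] R) (j : Fin d) :
    TruncWittFrame.map g (U.1 (a j)) = incl p n k R (e j)
      (TruncatedWittVector.mk p fun m => g (U.wittCoords a e (MvPolynomial.X (j, m)))) := by
  rw [← incl_coord_of_mem (U.2 _ _ (ha j)), map_incl]
  refine congrArg _ (TruncatedWittVector.ext fun m => ?_)
  rw [TruncWitt.coeff_map, TruncatedWittVector.coeff_mk, GradedPoints.wittCoords,
    MvPolynomial.aeval_X]
  rfl

variable [GradedAlgebra 𝒜]

/-- A lifting problem for the Witt coordinates along `S → S/I` is a graded point over `S/I` at which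
`f` is invertible, with prescribed lifts of its values at the `a_j`. The map of frames has
square-zero kernel, so étaleness of the `a_j` on `A_f` gives a unique algebra lift. Its
homogenization is a graded point over `S`, and universality turns this point into a homomorphism out
of `B`. -/
theorem GradedPoints.IsUniversal.formallyEtale_wittCoords (hU : U.IsUniversal) (hn : 1 ≤ n) {d : ℕ}
    {a : Fin d → A} {e : Fin d → ℤ} {f : A} (ha : ∀ j, a j ∈ 𝒜 (e j)) (hf : f ∈ 𝒜 0)
    (hE : ((algebraMap A (Localization.Away f)).comp
      (MvPolynomial.aeval (R := WittVector p k) a).toRingHom).FormallyEtale) :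
    ((algebraMap B (Localization.Away (constantTerm p k B hn (U.1 f)))).comp
      (U.wittCoords a e).toRingHom).FormallyEtale := by
  have hunit : ∀ {R : Type u} [CommRing R] [Algebra k R] (g : B →ₐ[k] R),
      IsUnit (g (constantTerm p k B hn (U.1 f))) → IsUnit (TruncWittFrame.map g (U.1 f)) := by
    intro R _ _ g hg
    refine isUnit_of_isUnit_constantTerm hn (map_mem_grading g (U.2 0 f hf)) ?_
    rwa [constantTerm_map]
  refine RingHom.FormallyEtale.of_forall_lift (fun S _ I hI α β hαβ => ?_)
    (fun S _ I hI γ γ' h h' => ?_)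
  -- The frame requires a `k`-algebra; the structure on `S` is the one dictated by `α` on constants.
  · algebraize [α.comp MvPolynomial.C]
    let π : S →ₐ[k] S ⧸ I := Ideal.Quotient.mkₐ k I
    have hπ : Function.Surjective π := Ideal.Quotient.mkₐ_surjective k I
    have hπker : RingHom.ker π ^ 2 = ⊥ := by
      rw [← hI]
      exact congrArg (· ^ 2) (Ideal.mk_ker (I := I))
    have hαβ' : ∀ x, π (α x) = β (algebraMap B _ (U.wittCoords a e x)) := RingHom.congr_fun hαβ
    let β₀ : B →ₐ[k] S ⧸ I := { β.comp (algebraMap B _) with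
      commutes' := fun c => by
        have := hαβ' (MvPolynomial.C c)
        rw [← MvPolynomial.algebraMap_eq, AlgHom.commutes] at this
        exact this.symm }
    have hβ₀ : IsUnit (β₀ (constantTerm p k B hn (U.1 f))) :=
      (IsLocalization.Away.algebraMap_isUnit _).map β
    obtain ⟨ψ, hψ, hψa⟩ := exists_algHom_lift_of_formallyEtale hE
      (π := TruncWittFrame.map (p := p) (n := n) π) (map_surjective hπ) (ker_map_sq hπker)
      (φ := (TruncWittFrame.map β₀).comp U.1) (hunit β₀ hβ₀)
      (s := fun j => incl p n k S (e j)
        (TruncatedWittVector.mk p fun m => α (MvPolynomial.X (j, m)))) (fun j => by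
        rw [map_incl, AlgHom.comp_apply, U.map_apply_eq_incl ha]
        refine congrArg _ (TruncatedWittVector.ext fun m => ?_)
        rw [TruncWitt.coeff_map, TruncatedWittVector.coeff_mk, TruncatedWittVector.coeff_mk]
        exact hαβ' _)
    obtain ⟨ψ', hψ'1, hψ'2⟩ := exists_graded_algHom_of_ker_sq 𝒜 (grading p n k S)
      (grading p n k (S ⧸ I)) (fun i s hs => map_mem_grading π hs) (ker_map_sq hπker) ψ
      (fun i x hx => by
        rw [← AlgHom.comp_apply, hψ]
        exact map_mem_grading β₀ (U.2 i x hx))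
    obtain ⟨γ₀, hγ₀⟩ := hU.exists_map_comp_eq (⟨ψ', fun i x hx => by
      rw [hψ'1 i x hx]
      exact SetLike.coe_mem _⟩ : GradedPoints p 𝒜 n S)
    replace hγ₀ : (TruncWittFrame.map γ₀).comp U.1 = ψ' := hγ₀
    have hγβ : π.comp γ₀ = β₀ := by
      refine hU.hom_ext ?_
      rw [← hψ, ← hψ'2, ← hγ₀]
      exact AlgHom.ext fun x => (TruncWittFrame.map_map γ₀ π _).symm
    have hγu : IsUnit (γ₀ (constantTerm p k B hn (U.1 f))) := by
      refine isUnit_of_isUnit_map_of_ker_sq (π := π.toRingHom) hπ hπker ?_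
      rw [← hγβ] at hβ₀
      exact hβ₀
    have hX : ∀ x, γ₀ (U.wittCoords a e (MvPolynomial.X x)) = α (MvPolynomial.X x) := by
      rintro ⟨j, m⟩
      have h1 : TruncWittFrame.map γ₀ (U.1 (a j)) = incl p n k S (e j)
          (TruncatedWittVector.mk p fun m => α (MvPolynomial.X (j, m))) := by
        rw [← AlgHom.comp_apply, hγ₀]
        change ψ' (a j) = _
        -- The prescribed value at `a j` is homogeneous of degree `e j`, so homogenization leaves it
        -- unchanged.
        rw [hψ'1 _ _ (ha j), hψa, coe_decompose, coord_incl_self]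
      rw [U.map_apply_eq_incl ha] at h1
      have h2 := congrArg (TruncatedWittVector.coeff m) (incl_injective _ h1)
      rwa [TruncatedWittVector.coeff_mk, TruncatedWittVector.coeff_mk] at h2
    refine ⟨IsLocalization.Away.lift (g := γ₀.toRingHom) _ hγu, ?_, ?_⟩
    · rw [← RingHom.comp_assoc, IsLocalization.Away.lift_comp]
      refine MvPolynomial.ringHom_ext (fun c => ?_) hX
      change γ₀ (U.wittCoords a e (MvPolynomial.C c)) = _
      rw [← MvPolynomial.algebraMap_eq, AlgHom.commutes, AlgHom.commutes]
      rfl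
    · refine IsLocalization.ringHom_ext (.powers (constantTerm p k B hn (U.1 f))) ?_
      rw [RingHom.comp_assoc, IsLocalization.Away.lift_comp]
      exact congrArg AlgHom.toRingHom hγβ
  -- Agreement on constants makes `γ` and `γ'` linear for one common `k`-algebra structure on `S`.
  · have hC : ∀ c, γ (algebraMap B _ (algebraMap k B c)) =
        γ' (algebraMap B _ (algebraMap k B c)) := by
      intro c
      have := RingHom.congr_fun h (algebraMap k _ c)
      simpa using this
    algebraize [(γ.comp (algebraMap B _)).comp (algebraMap k B)]
    let π : S →ₐ[k] S ⧸ I := Ideal.Quotient.mkₐ k I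
    have hπ : Function.Surjective π := Ideal.Quotient.mkₐ_surjective k I
    have hπker : RingHom.ker π ^ 2 = ⊥ := by
      rw [← hI]
      exact congrArg (· ^ 2) (Ideal.mk_ker (I := I))
    let γ₀ : B →ₐ[k] S := { γ.comp (algebraMap B _) with commutes' := fun c => rfl }
    let γ₀' : B →ₐ[k] S := { γ'.comp (algebraMap B _) with commutes' := fun c => (hC c).symm }
    have hγγ : γ₀ = γ₀' := by
      refine hU.hom_ext ?_
      have hfu : IsUnit (γ₀ (constantTerm p k B hn (U.1 f))) :=
        (IsLocalization.Away.algebraMap_isUnit _).map γ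
      refine algHom_ext_of_formallyEtale hE (π := TruncWittFrame.map (p := p) (n := n) π)
        (map_surjective hπ) (ker_map_sq hπker) ((hunit γ₀ hfu).map _) ?_ fun j => ?_
      · have h3 : π.comp γ₀ = π.comp γ₀' :=
          AlgHom.ext fun x => RingHom.congr_fun h' (algebraMap B _ x)
        refine AlgHom.ext fun x => ?_
        change TruncWittFrame.map π (TruncWittFrame.map γ₀ (U.1 x)) =
          TruncWittFrame.map π (TruncWittFrame.map γ₀' (U.1 x))
        rw [TruncWittFrame.map_map, TruncWittFrame.map_map, h3]
      · rw [AlgHom.comp_apply, AlgHom.comp_apply, U.map_apply_eq_incl ha,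
          U.map_apply_eq_incl ha]
        refine congrArg _ (congrArg _ (funext fun m => ?_))
        exact RingHom.congr_fun h (MvPolynomial.X (j, m))
    refine IsLocalization.ringHom_ext (.powers (constantTerm p k B hn (U.1 f))) ?_
    exact congrArg AlgHom.toRingHom hγγ

end UniversalPoint

/-! ### Smoothness of the representing algebras and of the reduction maps -/

section StandardSmooth

/-- Over a Noetherian ring finite type gives finite presentation, so the map is étale. -/
theorem RingHom.FormallyEtale.isStandardSmoothOfRelativeDimension_zero {Q L : Type u} [CommRing Q]
    [IsNoetherianRing Q] [CommRing L] {φ : Q →+* L} (hφ : φ.FormallyEtale) (hft : φ.FiniteType) :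
    φ.IsStandardSmoothOfRelativeDimension 0 := by
  rw [← RingHom.etale_iff_isStandardSmoothOfRelativeDimension_zero]
  algebraize [φ]
  have : Algebra.FinitePresentation Q L := Algebra.FinitePresentation.of_finiteType.1 ‹_›
  exact (⟨‹_›, ‹_›⟩ : Algebra.Etale Q L)

/-- The presentation without relations is submersive: its Jacobian is the empty determinant `1`. -/
theorem MvPolynomial.isStandardSmoothOfRelativeDimension (R σ : Type*) [CommRing R]
    [Finite σ] : Algebra.IsStandardSmoothOfRelativeDimension (Nat.card σ) R (MvPolynomial σ R) := by
  let P : Algebra.PreSubmersivePresentation R (MvPolynomial σ R) σ Empty :=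
    { toGenerators := Algebra.Generators.mvPolynomial R σ
      relation := Empty.elim
      span_range_relation_eq_ker := by
        rw [Set.range_eq_empty, Ideal.span_empty]
        symm
        change RingHom.ker (MvPolynomial.aeval (R := R) (MvPolynomial.X (σ := σ))) = ⊥
        rw [MvPolynomial.aeval_X_left]
        exact RingHom.ker_coe_equiv (RingEquiv.refl _)
      map := Empty.elim
      map_inj := fun a => a.elim }
  let P' : Algebra.SubmersivePresentation R (MvPolynomial σ R) σ Empty :=
    { toPreSubmersivePresentation := P
      jacobian_isUnit := by
        classical
        rw [Algebra.PreSubmersivePresentation.jacobian_eq_jacobiMatrix_det, Matrix.det_isEmpty,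
          map_one]
        exact isUnit_one }
  refine P'.isStandardSmoothOfRelativeDimension ?_
  simp [Algebra.Presentation.dimension]

theorem MvPolynomial.isStandardSmoothOfRelativeDimension_C (R σ : Type*) [CommRing R]
    [Finite σ] : (MvPolynomial.C : R →+* MvPolynomial σ R).IsStandardSmoothOfRelativeDimension
      (Nat.card σ) := by
  rw [← MvPolynomial.algebraMap_eq, RingHom.isStandardSmoothOfRelativeDimension_algebraMap]
  exact MvPolynomial.isStandardSmoothOfRelativeDimension R σ

end StandardSmooth

section Smoothness

open TruncWittFrame

variable {p : ℕ} [Fact p.Prime] {k : Type u} [Field k] [CharP k p] {A : Type u} [CommRing A]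
  [Algebra (WittVector p k) A] {𝒜 : ℤ → Submodule (WittVector p k) A} {n : ℕ}
  {B : Type u} [CommRing B] [Algebra k B] {B' : Type u} [CommRing B'] [Algebra k B']

theorem finiteType_of_corepresentableBy [GradedAlgebra 𝒜]
    [Algebra.FiniteType (WittVector p k) A] {B : CommAlgCat.{u} k}
    (h : (gradedPointsFunctor p 𝒜 n).CorepresentableBy B) : Algebra.FiniteType k B := by
  obtain ⟨B₀, hB₀, ⟨h₀⟩⟩ := exists_corepresentableBy 𝒜 n
  exact hB₀.equiv (CommAlgCat.algEquivOfIso (h₀.uniqueUpToIso h))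

/-- A graded point over `B` admits homogeneous étale coordinates on `A` near each prime of `B`. -/
theorem GradedPoints.exists_formallyEtale_coords [GradedAlgebra 𝒜] {d : ℕ}
    (hA : RingHom.Locally (RingHom.IsStandardSmoothOfRelativeDimension d)
      (algebraMap (WittVector p k) A)) (hn : 1 ≤ n) (U : GradedPoints p 𝒜 n B)
    (q : Ideal B) [q.IsPrime] :
    ∃ (a : Fin d → A) (e : Fin d → ℤ) (f : A), (∀ j, a j ∈ 𝒜 (e j)) ∧ f ∈ 𝒜 0 ∧
      constantTerm p k B hn (U.1 f) ∉ q ∧ ((algebraMap A (Localization.Away f)).comp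
        (MvPolynomial.aeval (R := WittVector p k) a).toRingHom).FormallyEtale := by
  -- `θ` kills all nonzero degrees, so the preimage of `q` is a prime at which homogeneous
  -- coordinates exist.
  let θ : A →+* B := (constantTerm p k B hn).comp U.1.toRingHom
  obtain ⟨a, e, f, ha, hf, hfq, hspan⟩ := exists_homogeneous_smul_mem_span 𝒜 hA (q.comap θ)
    fun i hi x hx => by
      obtain ⟨b, hb⟩ := U.2 i x hx
      have : θ x = 0 := by
        change constantTerm p k B hn (U.1 x) = 0
        rw [← hb, constantTerm_incl_of_ne hn hi]
      rw [Ideal.mem_comap, this]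
      exact zero_mem q
  exact ⟨a, e, f, ha, hf, hfq, formallyEtale_aeval_of_smul_mem_span hA hspan⟩

/-- The elements `t` with the property lie in no common maximal ideal, so they generate the unit
ideal. -/
theorem RingHom.locally_of_forall_isPrime {P : ∀ {R S : Type u} [CommRing R] [CommRing S],
    (R →+* S) → Prop} {R S : Type u} [CommRing R] [CommRing S] {φ : R →+* S}
    (h : ∀ q : Ideal S, q.IsPrime → ∃ t ∉ q, P ((algebraMap S (Localization.Away t)).comp φ)) :
    RingHom.Locally P φ := by
  refine ⟨{t | P ((algebraMap S (Localization.Away t)).comp φ)}, ?_, fun t ht => ht⟩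
  by_contra hne
  obtain ⟨q, hq, hle⟩ := Ideal.exists_le_maximal _ hne
  obtain ⟨t, htq, ht⟩ := h q hq.isPrime
  exact htq (hle (Ideal.subset_span ht))

variable [GradedAlgebra 𝒜] {d : ℕ} {U : GradedPoints p 𝒜 n B} {U' : GradedPoints p 𝒜 (n + 1) B'}

/-- Near each prime, `k → B` factors through the étale Witt coordinates from a polynomial ring in
`nd` variables. -/
theorem GradedPoints.IsUniversal.locally_isStandardSmooth [Algebra.FiniteType k B]
    (hU : U.IsUniversal) (hn : 1 ≤ n)
    (hA : RingHom.Locally (RingHom.IsStandardSmoothOfRelativeDimension d)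
      (algebraMap (WittVector p k) A)) :
    RingHom.Locally (RingHom.IsStandardSmoothOfRelativeDimension (n * d)) (algebraMap k B) := by
  refine RingHom.locally_of_forall_isPrime fun q _ => ?_
  obtain ⟨a, e, f, ha, hf, hfq, hE⟩ := U.exists_formallyEtale_coords hA hn q
  refine ⟨_, hfq, ?_⟩
  have h1 := hU.formallyEtale_wittCoords hn ha hf hE
  have h2 : (((algebraMap B (Localization.Away (constantTerm p k B hn (U.1 f)))).comp
      (U.wittCoords a e).toRingHom).comp MvPolynomial.C) = (algebraMap B _).comp (algebraMap k B) :=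
    (RingHom.comp_assoc _ _ _).trans (congrArg _ (U.wittCoords a e).comp_algebraMap)
  have h3 : ((algebraMap B (Localization.Away (constantTerm p k B hn (U.1 f)))).comp
      (algebraMap k B)).FiniteType := by
    rw [← IsScalarTower.algebraMap_eq, RingHom.finiteType_algebraMap]
    infer_instance
  have h4 := (h1.isStandardSmoothOfRelativeDimension_zero
    (RingHom.FiniteType.of_comp_finiteType (h2 ▸ h3))).comp
    (MvPolynomial.isStandardSmoothOfRelativeDimension_C k (Fin d × Fin n))
  rw [h2] at h4
  convert h4 using 1
  simp [mul_comm]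

/-- The same `a_j` and `f`, chosen at a prime of `B'`, give étale coordinates at both levels, on
localizations `L` of `B` and `L'` of `B'`. Adjoining the last Witt coefficients to `L` gives `L[X_1,
…, X_d] → L'`, which is étale by cancellation; thus `L → L'` has relative dimension `d`. -/
theorem GradedPoints.IsUniversal.locally_isStandardSmooth_of_reduction [Algebra.FiniteType k B]
    [Algebra.FiniteType k B'] (hU : U.IsUniversal) (hU' : U'.IsUniversal) (hn : 1 ≤ n)
    (hA : RingHom.Locally (RingHom.IsStandardSmoothOfRelativeDimension d)
      (algebraMap (WittVector p k) A)) {ρ : B →ₐ[k] B'}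
    (hρ : (TruncWittFrame.map ρ).comp U.1 = (reduction n.le_succ B').comp U'.1) :
    RingHom.Locally (RingHom.IsStandardSmoothOfRelativeDimension d) ρ.toRingHom := by
  refine RingHom.locally_of_forall_isPrime fun q' _ => ?_
  obtain ⟨a, e, f, ha, hf, hfq, hE⟩ :=
    U'.exists_formallyEtale_coords hA (hn.trans n.le_succ) q'
  refine ⟨_, hfq, ?_⟩
  have h1 := hU.formallyEtale_wittCoords hn ha hf hE
  have h1' := hU'.formallyEtale_wittCoords (hn.trans n.le_succ) ha hf hE
  have hρt : ρ (constantTerm p k B hn (U.1 f)) =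
      constantTerm p k B' (hn.trans n.le_succ) (U'.1 f) := by
    rw [← constantTerm_map, ← constantTerm_reduction hn]
    exact congrArg _ (AlgHom.congr_fun hρ f)
  -- Truncation keeps the first `n` coefficients.
  have hρc : ∀ j m, ρ (U.wittCoords a e (MvPolynomial.X (j, m))) =
      U'.wittCoords a e (MvPolynomial.X (j, m.castSucc)) := by
    intro j m
    rw [wittCoords, wittCoords, MvPolynomial.aeval_X, MvPolynomial.aeval_X]
    have h2 : coord p n k B' (e j) (TruncWittFrame.map ρ (U.1 (a j))) =
        coord p n k B' (e j) (reduction n.le_succ B' (U'.1 (a j))) :=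
      congrArg _ (AlgHom.congr_fun hρ (a j))
    rw [coord_map, coord_reduction] at h2
    have h3 := congrArg (TruncatedWittVector.coeff m) h2
    rw [TruncWitt.coeff_map, TruncatedWittVector.coeff_truncate] at h3
    exact h3
  generalize hL : algebraMap B (Localization.Away (constantTerm p k B hn (U.1 f))) = l at h1
  generalize hL' : algebraMap B'
    (Localization.Away (constantTerm p k B' (hn.trans n.le_succ) (U'.1 f))) = l' at h1' ⊢
  set L := Localization.Away (constantTerm p k B hn (U.1 f))
  set L' := Localization.Away (constantTerm p k B' (hn.trans n.le_succ) (U'.1 f))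
  have hunit : IsUnit (l'.comp ρ.toRingHom (constantTerm p k B hn (U.1 f))) := by
    rw [← hL']
    change IsUnit (algebraMap B' L' (ρ _))
    rw [hρt]
    exact IsLocalization.Away.algebraMap_isUnit _
  let ρL : L →+* L' := IsLocalization.Away.lift (S := L) (g := l'.comp ρ.toRingHom) _ hunit
  have hρL : ρL.comp l = l'.comp ρ.toRingHom := by
    rw [← hL]
    exact IsLocalization.Away.lift_comp _ _
  let φ : MvPolynomial (Fin d) L →+* L' := MvPolynomial.eval₂Hom ρL fun j =>
    l' (U'.wittCoords a e (MvPolynomial.X (j, Fin.last n)))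
  have hφC : φ.comp MvPolynomial.C = ρL := MvPolynomial.eval₂Hom_comp_C _ _
  -- `ι` is the level `n` coordinate map into `L` with the `d` last coefficients adjoined as free
  -- variables; `φ ∘ ι` is the level `n + 1` coordinate map.
  let ι : MvPolynomial (Fin d × Fin (n + 1)) k →+* MvPolynomial (Fin d) L :=
    MvPolynomial.eval₂Hom ((MvPolynomial.C.comp l).comp (algebraMap k B)) fun x =>
      Fin.lastCases (motive := fun _ => MvPolynomial (Fin d) L) (MvPolynomial.X x.1)
        (fun m => MvPolynomial.C (l (U.wittCoords a e (MvPolynomial.X (x.1, m))))) x.2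
  have hιC : ∀ c, ι (MvPolynomial.C c) = MvPolynomial.C (l (algebraMap k B c)) :=
    fun c => MvPolynomial.eval₂Hom_C _ _ c
  have hιlast : ∀ j, ι (MvPolynomial.X (j, Fin.last n)) = MvPolynomial.X j := fun j =>
    (MvPolynomial.eval₂Hom_X' _ _ _).trans (Fin.lastCases_last ..)
  have hιcast : ∀ j m, ι (MvPolynomial.X (j, Fin.castSucc m)) =
      MvPolynomial.C (l (U.wittCoords a e (MvPolynomial.X (j, m)))) := fun j m =>
    (MvPolynomial.eval₂Hom_X' _ _ _).trans (Fin.lastCases_castSucc ..)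
  have hφι : φ.comp ι = l'.comp (U'.wittCoords a e).toRingHom := by
    refine MvPolynomial.ringHom_ext (fun c => ?_) ?_
    · rw [RingHom.comp_apply, hιC, ← RingHom.comp_apply, hφC, ← RingHom.comp_apply, hρL]
      change l' (ρ _) = l' (U'.wittCoords a e (algebraMap k _ c))
      rw [AlgHom.commutes, AlgHom.commutes]
    · rintro ⟨j, m⟩
      rw [RingHom.comp_apply]
      induction m using Fin.lastCases with
      | last =>
        rw [hιlast]
        exact MvPolynomial.eval₂Hom_X' _ _ _
      | cast m =>
        rw [hιcast, ← RingHom.comp_apply, hφC, ← RingHom.comp_apply, hρL]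
        exact congrArg l' (hρc j m)
  have hφE : φ.FormallyEtale := by
    refine RingHom.FormallyEtale.of_forall_lift (fun S _ I hI α β hαβ => ?_)
      (fun S _ I hI γ γ' h h' => ?_)
    · have hker : RingHom.ker (Ideal.Quotient.mk I) ^ 2 = ⊥ := by rw [Ideal.mk_ker, hI]
      obtain ⟨γ, hγ, hγβ⟩ := h1'.exists_lift (π := Ideal.Quotient.mk I)
        Ideal.Quotient.mk_surjective hker (α := α.comp ι) (β := β)
        (by rw [← hφι, ← RingHom.comp_assoc, ← RingHom.comp_assoc, hαβ])
      rw [← hφι, ← RingHom.comp_assoc] at hγ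
      refine ⟨γ, ?_, hγβ⟩
      -- So far `γ ∘ φ` and `α` agree only after `ι`. On `L` they agree by infinitesimal uniqueness
      -- over the level `n` coordinates.
      have hC : (γ.comp φ).comp MvPolynomial.C = α.comp MvPolynomial.C := by
        refine h1.hom_ext (π := Ideal.Quotient.mk I) hker ?_ ?_
        · refine MvPolynomial.ringHom_ext (fun c => ?_) ?_
          · have := RingHom.congr_fun hγ (MvPolynomial.C c)
            rw [RingHom.comp_apply, RingHom.comp_apply α, hιC] at this
            change (γ.comp φ) (MvPolynomial.C (l (U.wittCoords a e (algebraMap k _ c)))) =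
              α (MvPolynomial.C (l (U.wittCoords a e (algebraMap k _ c))))
            rwa [AlgHom.commutes]
          · rintro ⟨j, m⟩
            have := RingHom.congr_fun hγ (MvPolynomial.X (j, Fin.castSucc m))
            rw [RingHom.comp_apply, RingHom.comp_apply α, hιcast] at this
            exact this
        · rw [← RingHom.comp_assoc, ← RingHom.comp_assoc, ← RingHom.comp_assoc, hγβ, hαβ]
      refine MvPolynomial.ringHom_ext (RingHom.congr_fun hC) fun j => ?_
      have := RingHom.congr_fun hγ (MvPolynomial.X (j, Fin.last n))
      rwa [RingHom.comp_apply, RingHom.comp_apply α, hιlast] at this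
    · refine h1'.hom_ext (π := Ideal.Quotient.mk I) (by rw [Ideal.mk_ker, hI]) ?_ h'
      rw [← hφι, ← RingHom.comp_assoc, ← RingHom.comp_assoc, h]
  -- `L` is Noetherian, as needed to pass from formally étale of finite type to étale.
  have : Algebra.FiniteType k L := inferInstance
  have : IsNoetherianRing L := Algebra.FiniteType.isNoetherianRing k L
  have h2 : ((φ.comp MvPolynomial.C).comp l) = l'.comp ρ.toRingHom := by rw [hφC, hρL]
  have h3 : φ.FiniteType := by
    have h4 : (l'.comp (algebraMap k B')).FiniteType := by
      rw [← hL', ← IsScalarTower.algebraMap_eq, RingHom.finiteType_algebraMap]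
      infer_instance
    refine RingHom.FiniteType.of_comp_finiteType
      (f := (MvPolynomial.C.comp l).comp (algebraMap k B)) ?_
    rwa [← RingHom.comp_assoc, ← RingHom.comp_assoc, h2, RingHom.comp_assoc,
      show ρ.toRingHom.comp (algebraMap k B) = algebraMap k B' from ρ.comp_algebraMap]
  have h5 : l.IsStandardSmoothOfRelativeDimension 0 := by
    rw [← hL]
    exact RingHom.IsStandardSmoothOfRelativeDimension.algebraMap_isLocalizationAway
      (constantTerm p k B hn (U.1 f))
  have h6 := ((hφE.isStandardSmoothOfRelativeDimension_zero h3).comp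
    (MvPolynomial.isStandardSmoothOfRelativeDimension_C L (Fin d))).comp h5
  rw [h2] at h6
  simpa using h6

/-- A point of `X_n` with values in a residue field `κ` lifts to `X_{n+1}(κ)`: reduction of frames
over `κ` has square-zero kernel, so smoothness of `A` gives an algebra lift, which is then
homogenized. -/
theorem GradedPoints.IsUniversal.comap_surjective_of_reduction
    [Algebra.FormallySmooth (WittVector p k) A] (hU : U.IsUniversal) (hU' : U'.IsUniversal)
    (hn : 1 ≤ n) {ρ : B →ₐ[k] B'}
    (hρ : (TruncWittFrame.map ρ).comp U.1 = (reduction n.le_succ B').comp U'.1) :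
    Function.Surjective (PrimeSpectrum.comap ρ.toRingHom) := by
  intro q
  let κ := q.asIdeal.ResidueField
  let ε : B →ₐ[k] κ := IsScalarTower.toAlgHom k B κ
  let φ : A →ₐ[WittVector p k] TruncWittFrame p n k κ := (TruncWittFrame.map ε).comp U.1
  have hker := ker_reduction_sq (p := p) (k := k) hn κ
  have hsurj := reduction_surjective (p := p) (k := k) (n := n) κ
  let ψ := Algebra.FormallySmooth.liftOfSurjective φ (reduction n.le_succ κ) hsurj ⟨2, hker⟩
  have hψ : (reduction n.le_succ κ).comp ψ = φ :=
    Algebra.FormallySmooth.comp_liftOfSurjective _ _ _ _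
  obtain ⟨ψ', hψ'1, hψ'2⟩ := exists_graded_algHom_of_ker_sq 𝒜 (grading p (n + 1) k κ)
    (grading p n k κ) (fun i s hs => reduction_mem_grading hs) hker ψ
    (fun i x hx => by
      rw [← AlgHom.comp_apply, hψ]
      exact map_mem_grading ε (U.2 i x hx))
  obtain ⟨γ, hγ⟩ := hU'.exists_map_comp_eq (⟨ψ', fun i x hx => by
    rw [hψ'1 i x hx]
    exact SetLike.coe_mem _⟩ : GradedPoints p 𝒜 (n + 1) κ)
  replace hγ : (TruncWittFrame.map γ).comp U'.1 = ψ' := hγ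
  have hγε : γ.comp ρ = ε := by
    refine hU.hom_ext ?_
    change _ = φ
    rw [← hψ, ← hψ'2, ← hγ]
    refine AlgHom.ext fun x => ?_
    change TruncWittFrame.map (γ.comp ρ) (U.1 x) =
      reduction n.le_succ κ (TruncWittFrame.map γ (U'.1 x))
    rw [reduction_map, ← TruncWittFrame.map_map]
    exact congrArg _ (AlgHom.congr_fun hρ x)
  -- Since `γ ∘ ρ` is the residue map at `q`, the kernel of `γ` lies over `q`.
  refine ⟨⟨RingHom.ker γ, RingHom.ker_isPrime _⟩, PrimeSpectrum.ext (Ideal.ext fun b => ?_)⟩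
  change γ (ρ b) = 0 ↔ _
  rw [← AlgHom.comp_apply, hγε]
  exact Ideal.algebraMap_residueField_eq_zero

end Smoothness

/-! ### The theorem, in the language of schemes. -/

theorem lemma4 (p : ℕ) [Fact p.Prime] (k : Type u) [Field k] [Finite k] [CharP k p]
    (A : Type u) [CommRing A] [Algebra (WittVector p k) A] [Algebra.FiniteType (WittVector p k) A]
    (𝒜 : ℤ → Submodule (WittVector p k) A) [GradedAlgebra 𝒜] (n : ℕ) (hn : 1 ≤ n) :
    (∃ B : CommAlgCat.{u} k, Algebra.FiniteType k B ∧
      Nonempty ((gradedPointsFunctor p 𝒜 n).CorepresentableBy B)) ∧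
    ∀ d : ℕ,
      SmoothOfRelativeDimension d
        (Spec.map (CommRingCat.ofHom (algebraMap (WittVector p k) A))) →
      (∀ (B : CommAlgCat.{u} k) (_ : (gradedPointsFunctor p 𝒜 n).CorepresentableBy B),
        SmoothOfRelativeDimension (n * d) (Spec.map (CommRingCat.ofHom (algebraMap k B)))) ∧
      ∀ (B B' : CommAlgCat.{u} k) (h : (gradedPointsFunctor p 𝒜 n).CorepresentableBy B)
        (h' : (gradedPointsFunctor p 𝒜 (n + 1)).CorepresentableBy B'),
        AlgebraicGeometry.Surjective (Spec.map (CommRingCat.ofHom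
          (representingHom (gradedPointsReduction p 𝒜 n) h h').hom.toRingHom)) ∧
        SmoothOfRelativeDimension d (Spec.map (CommRingCat.ofHom
          (representingHom (gradedPointsReduction p 𝒜 n) h h').hom.toRingHom)) := by
  refine ⟨exists_corepresentableBy 𝒜 n, fun d hd => ?_⟩
  have hA : RingHom.Locally (RingHom.IsStandardSmoothOfRelativeDimension d)
      (algebraMap (WittVector p k) A) :=
    (HasRingHomProperty.Spec_iff (P := @SmoothOfRelativeDimension d)).1 hd
  have := smooth_of_locally_isStandardSmoothOfRelativeDimension hA
  refine ⟨fun B h => ?_, fun B B' h h' => ⟨?_, ?_⟩⟩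
  · have := finiteType_of_corepresentableBy h
    exact (HasRingHomProperty.Spec_iff (P := @SmoothOfRelativeDimension (n * d))).2
      ((universalPoint_isUniversal h).locally_isStandardSmooth hn hA)
  · exact ⟨(universalPoint_isUniversal h).comap_surjective_of_reduction
      (universalPoint_isUniversal h') hn (map_representingHom_comp_universalPoint h h')⟩
  · have := finiteType_of_corepresentableBy h
    have := finiteType_of_corepresentableBy h'
    exact (HasRingHomProperty.Spec_iff (P := @SmoothOfRelativeDimension d)).2
      ((universalPoint_isUniversal h).locally_isStandardSmooth_of_reduction
        (universalPoint_isUniversal h') hn hA (map_representingHom_comp_universalPoint h h'))
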